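/- **Setting.** Let $\beta=(\beta_1,\dots,\beta_p)^T\in\mathbb R^p$ be such that all complex roots of $\lambda^p-\beta_1\lambda^{p-1}-\dots-\beta_p=0$ have modulus less than one; put $\delta(\beta)=1-\beta_1-\dots-\beta_p$ (which is then nonzero). Let $\nu\in\mathbb R$ and define $\mu$ by $\nu=\delta(\beta)\mu$. Let $\Pi$ be an arbitrary probability distribution on $\mathbb R$ and let $0\le\Gamma<\infty$. Let $G_0$ and $H$ be distribution functions on $\mathbb R$ with mean zero and finite variance, twice differentiable with bounded second derivatives; put $g_0=G_0'$ and, for $n\ge1$, $$A_n(x)=(1-n^{-1/2})G_0(x)+n^{-1/2}H(x).$$ For every $n\ge1$ and $0\le\gamma\le\Gamma$ put $\gamma_n=\min(1,\gamma n^{-1/2})$ and consider the following model (all sequences may depend on $n$ and $\gamma$). The innovations $\{\varepsilon_t\}_{t\in\mathbb Z}$ are i.i.d. with distribution function $A_n$; $\{v_t\}$ is the strictly stationary solution of $$v_t=\beta_1v_{t-1}+\dots+\beta_pv_{t-p}+\nu+\varepsilon_t,\quad t\in\mathbb Z;$$ $\{z_t\}$ are i.i.d. with values in $\{0,1\}$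 and $\mathsf P(z_t=1)=\gamma_n$; $\{\xi_t\}$ are i.i.d. with distribution $\Pi$; and the sequences $\{v_t\},\{z_t\},\{\xi_t\}$ are mutually independent. One observes $y_t=v_t+z_t\xi_t$, $t=1-p,\dots,n$. Let $\hat\mu_n$ and $\hat\beta_n=(\hat\beta_{1n},\dots,\hat\beta_{pn})^T$ be any estimators (measurable functions of $y_{1-p},\dots,y_n$) such that $n^{1/2}(\hat\mu_n-\mu)=O_P(1)$ and $n^{1/2}(\hat\beta_n-\beta)=O_P(1)$ as $n\to\infty$, uniformly in $0\le\gamma\le\Gamma$; here $X_n=O_P(1)$ uniformly means that for every $\eta>0$ there are $\Theta$ and $n_0$ with $\sup_{0\le\gamma\le\Gamma}\mathsf P(\|X_n\|>\Theta)\le\eta$ for all $n\ge n_0$. Put $\hat u_t=y_t-\hat\mu_n$ for $t=1-p,\dots,n$, and $$\hat\varepsilon_t=\hat u_t-\hat\beta_{1n}\hat u_{t-1}-\dots-\hat\beta_{pn}\hat u_{t-p},\quad t=1,\dots,n,$$ $$\hat G_n(x)=n^{-1}\sum_{t=1}^nI(\hat\varepsilon_t\le x),\qquad G_n(x)=n^{-1}\sum_{t=1}^nI(\varepsilon_t\le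 x).$$ **Theorem.** For every fixed $x\in\mathbb R$ and every $\delta>0$, $$\sup_{0\le\gamma\le\Gamma}\mathsf P\Bigl(\bigl|n^{1/2}[\hat G_n(x)-G_n(x)]-g_0(x)\,\delta(\beta)\,n^{1/2}(\hat\mu_n-\mu)-\gamma\Delta_0(x,\Pi)\bigr|>\delta\Bigr)\to0,\qquad n\to\infty,$$ where $$\Delta_0(x,\Pi)=\sum_{j=0}^p\bigl[\mathsf E\,G_0(x+\beta_j\xi_1)-G_0(x)\bigr],\qquad \beta_0=-1.$$ -/

import Mathlib

open MeasureTheory ProbabilityTheory Filter Topology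

noncomputable section

namespace ContaminatedAR

/-- All complex roots of the characteristic equation
`lam ^ p = β₁ lam ^ (p - 1) + ... + β_p` have modulus less than one
(the coefficient `β_{j+1}` is `β j`, for `j : Fin p`). -/
def StableRoots {p : ℕ} (β : Fin p → ℝ) : Prop :=
  ∀ lam : ℂ, lam ^ p - ∑ j : Fin p, (β j : ℂ) * lam ^ (p - 1 - (j : ℕ)) = 0 → ‖lam‖ < 1

/-- `δ(β) = 1 - β₁ - ... - β_p`. -/
def deltaCoeff {p : ℕ} (β : Fin p → ℝ) : ℝ := 1 - ∑ j, β j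

/-- The conditions on a distribution with distribution function `cdf Q`: zero mean, finite variance,
and a twice differentiable distribution function whose second derivative is bounded. -/
structure SmoothCentered (Q : Measure ℝ) : Prop where
  finite_variance : MemLp id 2 Q
  mean_zero : ∫ s, s ∂Q = 0
  differentiable : Differentiable ℝ (fun x => cdf Q x)
  differentiable_deriv : Differentiable ℝ (deriv (fun x => cdf Q x))
  bounded_second : ∃ C : ℝ, ∀ x, |deriv (deriv (fun x => cdf Q x)) x| ≤ C

/-- The local mixture `A_n(x) = (1 - n^{-1/2}) G₀(x) + n^{-1/2} H(x)`, where `G₀`, `H` are the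
distribution functions of `Q₀`, `Q₁`. -/
def mixtureCdf (Q₀ Q₁ : Measure ℝ) (n : ℕ) (x : ℝ) : ℝ :=
  (1 - (√(n : ℝ))⁻¹) * cdf Q₀ x + (√(n : ℝ))⁻¹ * cdf Q₁ x

/-- The contamination level `γ_n = min(1, γ / √n)`. -/
def contaminationLevel (γ : ℝ) (n : ℕ) : ℝ := min 1 (γ / √(n : ℝ))

/-- On the probability space `(Ω, P)`: `ε` is an i.i.d. sequence with distribution function `A`,
`v` is a (strictly) stationary solution of
`v_t = β₁ v_{t-1} + ... + β_p v_{t-p} + ν + ε_t`, `t ∈ ℤ`,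
`z` is an i.i.d. Bernoulli sequence with success probability `q`, `ξ` is i.i.d. with law `Π`, and
the sequences `v`, `z`, `ξ` are mutually independent. -/
structure IsModel {Ω : Type*} [MeasurableSpace Ω] (P : Measure Ω) {p : ℕ} (β : Fin p → ℝ) (ν : ℝ)
    (A : ℝ → ℝ) (q : ℝ) (Pi : Measure ℝ) (ε v z ξ : ℤ → Ω → ℝ) : Prop where
  measurable_innov : ∀ t, Measurable (ε t)
  measurable_v : ∀ t, Measurable (v t)
  measurable_z : ∀ t, Measurable (z t)
  measurable_outlier : ∀ t, Measurable (ξ t)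
  indep_innov : iIndepFun ε P
  law_innov : ∀ t x, P.real {ω | ε t ω ≤ x} = A x
  ar_equation : ∀ t, ∀ᵐ ω ∂P, v t ω = ∑ j : Fin p, β j * v (t - 1 - (j : ℤ)) ω + ν + ε t ω
  stationary : ∀ h : ℤ, P.map (fun ω (t : ℤ) => v (t + h) ω) = P.map (fun ω (t : ℤ) => v t ω)
  indep_z : iIndepFun z P
  z_values : ∀ t, ∀ᵐ ω ∂P, z t ω = 0 ∨ z t ω = 1
  z_prob : ∀ t, P.real {ω | z t ω = 1} = q
  indep_outlier : iIndepFun ξ P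
  law_outlier : ∀ t, P.map (ξ t) = Pi
  indep_sequences : iIndepFun
    ![fun ω (t : ℤ) => v t ω, fun ω (t : ℤ) => z t ω, fun ω (t : ℤ) => ξ t ω] P

/-- The observed process `y_t = v_t + z_t ξ_t`. -/
def obsProcess {Ω : Type*} (v z ξ : ℤ → Ω → ℝ) (ω : Ω) (t : ℤ) : ℝ := v t ω + z t ω * ξ t ω

/-- Sample space of the observations `y_{1-p}, ..., y_n`. -/
abbrev Sample (p n : ℕ) : Type := Set.Icc (1 - (p : ℤ)) (n : ℤ) → ℝ

/-- The observed sample `y_{1-p}, ..., y_n`. -/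
def sample (p n : ℕ) (y : ℤ → ℝ) : Sample p n := fun t => y t

/-- The residual `(y_t - m) - b₁ (y_{t-1} - m) - ... - b_p (y_{t-p} - m)`. -/
def residual {p : ℕ} (m : ℝ) (b : Fin p → ℝ) (y : ℤ → ℝ) (t : ℤ) : ℝ :=
  (y t - m) - ∑ j : Fin p, b j * (y (t - 1 - (j : ℤ)) - m)

/-- The empirical distribution function of `e_1, ..., e_n`. -/
def empiricalCdf (n : ℕ) (e : ℤ → ℝ) (x : ℝ) : ℝ :=
  (n : ℝ)⁻¹ * ∑ t ∈ Finset.Icc (1 : ℤ) n, (Set.Iic x).indicator (fun _ => (1 : ℝ)) (e t)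

/-- The shift `Δ₀(x, Π) = ∑_{j=0}^p [E G₀(x + β_j ξ₁) - G₀(x)]` with `β₀ = -1`, where `G₀` is the
distribution function of `Q₀` and `ξ₁` has law `Π`. -/
def outlierShift {p : ℕ} (β : Fin p → ℝ) (Q₀ Pi : Measure ℝ) (x : ℝ) : ℝ :=
  ∑ j : Fin (p + 1), ((∫ s, cdf Q₀ (x + Matrix.vecCons (-1) β j * s) ∂Pi) - cdf Q₀ x)

/-- `X_{n,γ} = O_P(1)` as `n → ∞`, uniformly in `0 ≤ γ ≤ Γ`. -/
def UniformlyBigOP {Ω : ℕ → ℝ → Type*} [∀ n γ, MeasurableSpace (Ω n γ)]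
    (P : ∀ n γ, Measure (Ω n γ)) (Γ : ℝ) {E : Type*} [Norm E] (X : ∀ n γ, Ω n γ → E) : Prop :=
  ∀ η : ℝ, 0 < η → ∃ Θ : ℝ, ∀ᶠ n : ℕ in atTop, ∀ γ ∈ Set.Icc 0 Γ,
    P n γ {ω | Θ < ‖X n γ ω‖} ≤ ENNReal.ofReal η

end ContaminatedAR

end

set_option linter.unusedSectionVars false

/-! Write h = n^{-1/2}, A = A_n and u_t = v_t - μ. A residual is at most x exactly when ε_t ≤ x +
D_t, where D_t = shift_t + h * pert_t. Here shift_t collects the outliers acting through the true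
coefficients, and pert_t is affine in the scaled errors τ = √n (m - μ)(1 - ∑ b_j) and s = √n (b - β)
(`residual_le_iff`). The object of study is thus h ∑ [I(ε_t ≤ x + D_t) - I(ε_t ≤ x)].

For deterministic (τ, s), D_t is a function of the past of v and of z, ξ, and ε_t is independent of
all these (`indepFun_innov`). Subtracting A(x + D_t) - A(x) leaves orthogonal terms whose second
moments are at most 4 E|A(x + D_t) - A(x)| = O(h), so h times their sum is O(h^{1/2}) in mean
(`l1Le_sum_centredStep`). In the compensator, times without outliers give A'(x) h pert_t by Taylor.
The scaled sum of these is A'(x) τ up to a negligible term, since sums of n values u_t are O(√n) in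
mean square (`integral_sum_sq_le`, from the absolutely summable moving average). A single outlier
contributes G₀(x + β_j ξ) - G₀(x), and a law of large numbers at frequency γh turns these into γΔ₀
(`l1Le_sum_outlier`). Two outliers within p + 1 consecutive times, or an outlier together with a
parameter error, contribute o(h) per time in mean. Since Π may have no moments, the effect of lagged
outliers on pert is truncated at 1 and treated by dominated convergence.

The estimators depend on the whole sample, so their D_t does not depend on the past alone. With high
probability (τ, s) lies in a fixed ball, which finitely many balls of radius κ cover. Monotonicity
in the threshold brackets the process between those at a deterministic centre, widened by ±κ
(`increment_bracket`); the widening costs O(κ). Finally A'(x) tends to g₀(x), and 1 - ∑ b_j differs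
from δ(β) by O(h) when the scaled errors are bounded. The bounds involve γ only through γ ≤ Γ, which
gives uniformity. -/

namespace ContaminatedAR

/-! ### The autoregressive recursion -/

section Recursion

variable {p : ℕ}

/-- The transposed companion matrix of the recursion `u_t = ∑ β_j u_{t-1-j} + e_t`. -/
def companion {R : Type*} [CommRing R] (β : Fin p → R) : Matrix (Fin p) (Fin p) R :=
  fun j i => (if (i : ℕ) = 0 then β j else 0) + (if (i : ℕ) = (j : ℕ) + 1 then 1 else 0)

/-- Coefficients of the remote past after `k` substitutions of the recursion into itself. -/
def remoteCoeff (β : Fin p → ℝ) (k : ℕ) : Fin p → ℝ := (companion β ^ k).mulVec β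

/-- The coefficients of the moving-average representation. -/
def maCoeff (β : Fin p → ℝ) : ℕ → ℝ
  | 0 => 1
  | k + 1 => ∑ i : Fin p, if (i : ℕ) = 0 then remoteCoeff β k i else 0

theorem remoteCoeff_succ (β : Fin p → ℝ) (k : ℕ) :
    remoteCoeff β (k + 1) = (companion β).mulVec (remoteCoeff β k) := by
  simp [remoteCoeff, pow_succ', Matrix.mulVec_mulVec]

/-- Column 0 of the companion matrix applies the recursion and the other columns shift, so the
product advances the lag vector by one step and misses only the innovation in coordinate 0. -/
theorem vecMul_companion (β : Fin p → ℝ) (u e : ℤ → ℝ)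
    (h : ∀ t, u t = ∑ j : Fin p, β j * u (t - 1 - (j : ℤ)) + e t) (T : ℤ) (i : Fin p) :
    Matrix.vecMul (fun j : Fin p => u (T - 1 - (j : ℤ))) (companion β) i
      = u (T - (i : ℤ)) - if (i : ℕ) = 0 then e T else 0 := by
  rw [Matrix.vecMul, dotProduct]
  simp only [companion, mul_add, Finset.sum_add_distrib]
  by_cases hi : (i : ℕ) = 0
  · have h1 : ∀ j : Fin p, ¬ ((0 : ℕ) = (j : ℕ) + 1) := fun j => by omega
    simp only [hi, if_true, h1, if_false, mul_zero, Finset.sum_const_zero, add_zero]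
    have := h T
    simp only [Nat.cast_zero, sub_zero]
    rw [this]
    simp [mul_comm]
  · simp only [hi, if_false, mul_zero, Finset.sum_const_zero, zero_add, sub_zero]
    rw [Finset.sum_eq_single ⟨(i : ℕ) - 1, by omega⟩]
    · have h2 : (i : ℕ) = ((i : ℕ) - 1) + 1 := by omega
      simp only [← h2, if_true, mul_one]
      congr 1
      have : (((i : ℕ) - 1 : ℕ) : ℤ) = (i : ℤ) - 1 := by omega
      rw [this]; ring
    · intro j _ hj
      rw [if_neg, mul_zero]
      intro hij
      apply hj
      ext
      simp; omega
    · simp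

/-- Iterating the recursion expresses `u_t` by innovations and the remote past. -/
theorem recursion_iterate (β : Fin p → ℝ) (u e : ℤ → ℝ)
    (h : ∀ t, u t = ∑ j : Fin p, β j * u (t - 1 - (j : ℤ)) + e t) (t : ℤ) (k : ℕ) :
    u t = ∑ i ∈ Finset.range (k + 1), maCoeff β i * e (t - (i : ℤ))
      + ∑ j : Fin p, remoteCoeff β k j * u (t - k - 1 - (j : ℤ)) := by
  induction k with
  | zero =>
    have := h t
    simp only [zero_add, Finset.range_one, Finset.sum_singleton, maCoeff, remoteCoeff, pow_zero,
      Matrix.one_mulVec, Nat.cast_zero, sub_zero, one_mul]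
    linarith
  | succ k ih =>
    rw [Finset.sum_range_succ, ih, add_assoc]
    congr 1
    -- The companion matrix is moved from the coefficients onto the lag vector, where it is one step
    -- of the recursion. The innovation split off there is the new moving-average term.
    have key : ∑ j : Fin p, remoteCoeff β (k + 1) j * u (t - (k : ℤ) - 1 - 1 - (j : ℤ))
        = ∑ i : Fin p, (u (t - (k : ℤ) - 1 - (i : ℤ)) -
            if (i : ℕ) = 0 then e (t - (k : ℤ) - 1) else 0) * remoteCoeff β k i := by
      have := Matrix.dotProduct_mulVec (fun j : Fin p => u (t - (k : ℤ) - 1 - 1 - (j : ℤ)))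
        (companion β) (remoteCoeff β k)
      rw [← remoteCoeff_succ] at this
      rw [dotProduct, dotProduct] at this
      simp only [vecMul_companion β u e h] at this
      rw [← this]
      exact Finset.sum_congr rfl fun _ _ => mul_comm _ _
    have e1 : t - ((k + 1 : ℕ) : ℤ) = t - (k : ℤ) - 1 := by push_cast; ring
    rw [e1, key, maCoeff, Finset.sum_mul, ← Finset.sum_add_distrib]
    refine Finset.sum_congr rfl fun i _ => ?_
    split_ifs <;> ring

/-- The rows of the eigenvector equation determine every coordinate from c 0 by Horner's scheme, and
the last row then says that c 0 times the characteristic polynomial at `lam` vanishes. Since c 0 = 0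
would make the eigenvector zero, `lam` is a characteristic root. -/
theorem spectrum_companion_norm_lt_one {β : Fin p → ℝ} (hβ : StableRoots β) {lam : ℂ}
    (h : lam ∈ spectrum ℂ (companion (fun j => (β j : ℂ)))) : ‖lam‖ < 1 := by
  rw [← Matrix.spectrum_toLin', ← Module.End.hasEigenvalue_iff_mem_spectrum] at h
  obtain ⟨c, hc⟩ := h.exists_hasEigenvector
  have hc0 := hc.2
  have hc1 := hc.apply_eq_smul
  rw [Matrix.toLin'_apply] at hc1
  obtain _ | q := p
  · exact (hc0 (Subsingleton.elim _ _)).elim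
  have h1 : ∀ j : Fin (q + 1), c 0 * (β j : ℂ)
      + (if hj : (j : ℕ) + 1 < q + 1 then c ⟨(j : ℕ) + 1, hj⟩ else 0) = lam * c j := by
    intro j
    have := congrFun hc1 j
    rw [Matrix.mulVec, dotProduct] at this
    simp only [companion, add_mul, Finset.sum_add_distrib, Pi.smul_apply, smul_eq_mul] at this
    rw [← this]
    congr 1
    · rw [Finset.sum_eq_single 0]
      · simp [mul_comm]
      · intro i _ hi
        have : (i : ℕ) ≠ 0 := fun h => hi (Fin.ext h)
        simp [this]
      · simp
    · split_ifs with hj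
      · rw [Finset.sum_eq_single ⟨(j : ℕ) + 1, hj⟩]
        · simp
        · intro i _ hi
          have : (i : ℕ) ≠ (j : ℕ) + 1 := fun h => hi (Fin.ext h)
          simp [this]
        · simp
      · refine (Finset.sum_eq_zero fun i _ => ?_).symm
        have : (i : ℕ) ≠ (j : ℕ) + 1 := by omega
        simp [this]
  have h2 : ∀ (k : ℕ) (hk : k < q + 1), c ⟨k, hk⟩ = c 0 * (lam ^ k
      - ∑ j ∈ Finset.range k, (if hj : j < q + 1 then (β ⟨j, hj⟩ : ℂ) else 0)
          * lam ^ (k - 1 - j)) := by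
    intro k
    induction k with
    | zero => intro hk; simp
    | succ k ih =>
      intro hk
      have := h1 ⟨k, by omega⟩
      simp only [hk, dif_pos] at this
      rw [ih (by omega)] at this
      rw [eq_sub_of_add_eq' this, Finset.sum_range_succ]
      have hs : ∑ j ∈ Finset.range k, (if hj : j < q + 1 then (β ⟨j, hj⟩ : ℂ) else 0)
          * lam ^ (k + 1 - 1 - j) = lam * ∑ j ∈ Finset.range k,
            (if hj : j < q + 1 then (β ⟨j, hj⟩ : ℂ) else 0) * lam ^ (k - 1 - j) := by
        rw [Finset.mul_sum]
        refine Finset.sum_congr rfl fun j hj => ?_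
        have : k + 1 - 1 - j = (k - 1 - j) + 1 := by
          have := Finset.mem_range.1 hj; omega
        rw [this, pow_succ]; ring
      rw [hs, dif_pos (show k < q + 1 by omega)]
      simp
      ring
  have hc00 : c 0 ≠ 0 := by
    intro h0
    apply hc0
    ext ⟨k, hk⟩
    rw [h2 k hk, h0]; simp
  apply hβ
  -- The last row has no successor coordinate and closes the scheme into the characteristic
  -- equation.
  have h3 := h1 (Fin.last q)
  have hlast := h2 q (by omega)
  have : (⟨q, by omega⟩ : Fin (q + 1)) = Fin.last q := rfl
  rw [this] at hlast
  rw [hlast] at h3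
  simp only [Fin.val_last, lt_irrefl, dif_neg, not_false_eq_true, add_zero] at h3
  have h4 : (β (Fin.last q) : ℂ) = lam * (lam ^ q
      - ∑ j ∈ Finset.range q, (if hj : j < q + 1 then (β ⟨j, hj⟩ : ℂ) else 0)
          * lam ^ (q - 1 - j)) := by
    apply mul_left_cancel₀ hc00
    rw [h3]; ring
  rw [Fin.sum_univ_castSucc, h4]
  have h5 : ∑ i : Fin q, (β i.castSucc : ℂ) * lam ^ (q + 1 - 1 - ((i.castSucc : Fin (q + 1)) : ℕ))
      = lam * ∑ j ∈ Finset.range q, (if hj : j < q + 1 then (β ⟨j, hj⟩ : ℂ) else 0)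
          * lam ^ (q - 1 - j) := by
    rw [Finset.mul_sum, Finset.sum_range]
    refine Finset.sum_congr rfl fun j _ => ?_
    rw [dif_pos (show (j : ℕ) < q + 1 by omega)]
    have : q + 1 - 1 - ((j.castSucc : Fin (q + 1)) : ℕ) = (q - 1 - j) + 1 := by
      have := j.2; simp; omega
    rw [this, pow_succ]
    have : (⟨(j : ℕ), by omega⟩ : Fin (q + 1)) = j.castSucc := rfl
    rw [this]; ring
  rw [h5]
  simp
  ring

-- Gelfand's formula: the spectral radius is below 1, so the powers of the complexified companion
-- matrix eventually decay geometrically. The operator norm used is the one adapted to the sup norm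
-- on vectors.
attribute [local instance] Matrix.linftyOpNormedRing Matrix.linftyOpNormedAlgebra in
theorem exists_remoteCoeff_bound {β : Fin p → ℝ} (hβ : StableRoots β) :
    ∃ r : ℝ, 0 ≤ r ∧ r < 1 ∧ ∀ᶠ k : ℕ in atTop, ∀ j, |remoteCoeff β k j| ≤ r ^ k * ‖β‖ := by
  obtain _ | q := p
  · exact ⟨0, le_rfl, one_pos, Eventually.of_forall fun k j => j.elim0⟩
  set S : Matrix (Fin (q + 1)) (Fin (q + 1)) ℂ := companion (fun j => (β j : ℂ)) with hS
  have hSβ : (companion β).map (Complex.ofRealHom) = S := by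
    ext j i
    simp only [companion, hS, Matrix.map_apply, map_add]
    congr 1 <;> split_ifs <;> simp
  have hr : spectralRadius ℂ S < (1 : NNReal) :=
    spectrum.spectralRadius_lt_of_forall_lt S fun z hz => by
      have := spectrum_companion_norm_lt_one hβ hz
      exact_mod_cast this
  obtain ⟨r, hr1, hr2⟩ := ENNReal.lt_iff_exists_nnreal_btwn.1 hr
  refine ⟨r, r.2, by exact_mod_cast hr2, ?_⟩
  have hg := (spectrum.pow_nnnorm_pow_one_div_tendsto_nhds_spectralRadius S).eventually_lt_const hr1
  filter_upwards [hg, eventually_ge_atTop 1] with k hk hk1 j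
  have h1 : ‖S ^ k‖ ≤ (r : ℝ) ^ k := by
    have h2 : (‖S ^ k‖₊ : ENNReal) ≤ (r : ENNReal) ^ k := by
      have h3 := ENNReal.rpow_le_rpow hk.le (show (0 : ℝ) ≤ k by positivity)
      rw [← ENNReal.rpow_mul, one_div, inv_mul_cancel₀ (by positivity), ENNReal.rpow_one,
        ENNReal.rpow_natCast] at h3
      exact h3
    exact_mod_cast h2
  have h4 : ((remoteCoeff β k j : ℝ) : ℂ) = (S ^ k).mulVec (fun j => (β j : ℂ)) j := by
    have h5 : S ^ k = (companion β ^ k).map Complex.ofRealHom := by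
      rw [← hSβ, Matrix.map_pow]
    rw [h5, remoteCoeff]
    simp [Matrix.mulVec, dotProduct]
  have h6 : ‖(fun j => (β j : ℂ))‖ = ‖β‖ := by
    simp [Pi.norm_def]
  calc |remoteCoeff β k j| = ‖((remoteCoeff β k j : ℝ) : ℂ)‖ := by simp
    _ ≤ ‖(S ^ k).mulVec (fun j => (β j : ℂ))‖ := by rw [h4]; exact norm_le_pi_norm _ j
    _ ≤ ‖S ^ k‖ * ‖(fun j => (β j : ℂ))‖ := Matrix.linfty_opNorm_mulVec _ _
    _ ≤ r ^ k * ‖β‖ := by rw [h6]; gcongr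

theorem tendsto_remoteCoeff {β : Fin p → ℝ} (hβ : StableRoots β) (j : Fin p) :
    Tendsto (fun k => remoteCoeff β k j) atTop (𝓝 0) := by
  obtain ⟨r, h0, h1, hr⟩ := exists_remoteCoeff_bound hβ
  refine squeeze_zero_norm' (hr.mono fun k hk => hk j) ?_
  simpa using (tendsto_pow_atTop_nhds_zero_of_lt_one h0 h1).mul_const ‖β‖

/-- Absolute summability is what makes the second moment of a sum of `v t - μ` over `s` of order
`s.card` (`eLpNorm_sum_le`). -/
theorem summable_abs_maCoeff {β : Fin p → ℝ} (hβ : StableRoots β) :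
    Summable fun k => |maCoeff β k| := by
  obtain ⟨r, h0, h1, hr⟩ := exists_remoteCoeff_bound hβ
  rw [← summable_nat_add_iff 1]
  refine Summable.of_norm_bounded_eventually_nat
    (g := fun k => ∑ _i : Fin p, r ^ k * ‖β‖) ?_ ?_
  · exact summable_sum fun i _ => (summable_geometric_of_lt_one h0 h1).mul_right _
  · filter_upwards [hr] with k hk
    rw [Real.norm_eq_abs, abs_abs, maCoeff]
    refine (Finset.abs_sum_le_sum_abs _ _).trans (Finset.sum_le_sum fun i _ => ?_)
    split_ifs
    · exact hk i
    · simp; positivity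

end Recursion

/-! ### Probabilistic tools -/

section Tools

variable {Ω : Type*} [MeasurableSpace Ω] {P : Measure Ω} [IsProbabilityMeasure P]

/-- The joint law is a threefold product, which can be reassociated. It serves with X an innovation,
Y the past of v and Z the contamination. -/
theorem indepFun_prodMk_of_indepFun {𝓧 𝓨 𝓩 : Type*} [MeasurableSpace 𝓧] [MeasurableSpace 𝓨]
    [MeasurableSpace 𝓩] {X : Ω → 𝓧} {Y : Ω → 𝓨} {Z : Ω → 𝓩} (hX : Measurable X)
    (hY : Measurable Y) (hZ : Measurable Z) (h1 : IndepFun X Y P)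
    (h2 : IndepFun (fun ω => (X ω, Y ω)) Z P) : IndepFun X (fun ω => (Y ω, Z ω)) P := by
  have := Measure.isProbabilityMeasure_map (μ := P) hX.aemeasurable
  have := Measure.isProbabilityMeasure_map (μ := P) hY.aemeasurable
  have := Measure.isProbabilityMeasure_map (μ := P) hZ.aemeasurable
  rw [indepFun_iff_map_prod_eq_prod_map_map (by fun_prop) (by fun_prop)] at *
  have h3 : P.map (fun ω => (Y ω, Z ω)) = (P.map Y).prod (P.map Z) := by
    have h5 : P.map Y = (P.map (fun ω => (X ω, Y ω))).map Prod.snd := by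
      rw [Measure.map_map (by fun_prop) (by fun_prop)]; rfl
    calc P.map (fun ω => (Y ω, Z ω))
        = (P.map (fun ω => ((X ω, Y ω), Z ω))).map (Prod.map Prod.snd id) := by
          rw [Measure.map_map (by fun_prop) (by fun_prop)]; rfl
      _ = (P.map Y).prod (P.map Z) := by
          rw [h2, ← Measure.map_prod_map _ _ (by fun_prop) (by fun_prop), ← h5, Measure.map_id]
  rw [h3]
  calc P.map (fun ω => (X ω, (Y ω, Z ω)))
      = (P.map (fun ω => ((X ω, Y ω), Z ω))).map MeasurableEquiv.prodAssoc := by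
        rw [Measure.map_map (by fun_prop) (by fun_prop)]; rfl
    _ = _ := by
        rw [h2, h1]
        exact (measurePreserving_prodAssoc _ _ _).map_eq

/-- A member of an independent sequence is independent of the past. -/
theorem indepFun_past {X : ℤ → Ω → ℝ} (hX : ∀ t, Measurable (X t)) (h : iIndepFun X P) (t : ℤ) :
    IndepFun (X t) (fun ω (r : ℤ) => if r < t then X r ω else 0) P := by
  have h1 := indep_iSup_of_disjoint (fun i => (hX i).comap_le) h.iIndep
    (S := {t}) (T := Set.Iio t) (by simp)
  rw [IndepFun_iff_Indep]
  refine indep_of_indep_of_le_left (indep_of_indep_of_le_right h1 ?_) ?_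
  · rw [← measurable_iff_comap_le]
    refine (@measurable_pi_iff _ _ _ (_) _ _).2 fun r => ?_
    by_cases hr : r < t
    · simp only [hr, if_true]
      refine Measurable.mono (comap_measurable (X r)) ?_ le_rfl
      exact le_iSup₂_of_le (f := fun i (_ : i ∈ Set.Iio t) => MeasurableSpace.comap (X i) _)
        r hr le_rfl
    · simp only [hr, if_false]
      exact measurable_const
  · simp

theorem integral_sq_sum_of_orthogonal {ι : Type*} (s : Finset ι) (X : ι → Ω → ℝ)
    (hX : ∀ i ∈ s, MemLp (X i) 2 P)
    (h : ∀ i ∈ s, ∀ j ∈ s, i ≠ j → ∫ ω, X i ω * X j ω ∂P = 0) :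
    ∫ ω, (∑ i ∈ s, X i ω) ^ 2 ∂P = ∑ i ∈ s, ∫ ω, X i ω ^ 2 ∂P := by
  have hint : ∀ i ∈ s, ∀ j ∈ s, Integrable (fun ω => X i ω * X j ω) P :=
    fun i hi j hj => (hX i hi).integrable_mul (hX j hj)
  simp_rw [sq, Finset.sum_mul_sum]
  rw [integral_finsetSum _ fun i hi => integrable_finsetSum _ fun j hj => hint i hi j hj]
  refine Finset.sum_congr rfl fun i hi => ?_
  rw [integral_finsetSum _ fun j hj => hint i hi j hj, Finset.sum_eq_single_of_mem i hi]
  exact fun j hj hij => h i hi j hj hij.symm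

theorem eLpNorm_two_le_of_integral_sq_le {f : Ω → ℝ} (hf : MemLp f 2 P) {B : ℝ}
    (h : ∫ ω, f ω ^ 2 ∂P ≤ B) : eLpNorm f 2 P ≤ ENNReal.ofReal (√B) := by
  rw [hf.eLpNorm_eq_integral_rpow_norm (by simp) (by simp)]
  apply ENNReal.ofReal_le_ofReal
  rw [Real.sqrt_eq_rpow]
  simp only [ENNReal.toReal_ofNat, Real.norm_eq_abs, Real.rpow_two, sq_abs]
  rw [one_div]
  exact Real.rpow_le_rpow (integral_nonneg fun _ => by positivity) h (by positivity)

theorem integral_sq_le_of_eLpNorm_two_le {f : Ω → ℝ} (hf : MemLp f 2 P) {B : ℝ} (hB : 0 ≤ B)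
    (h : eLpNorm f 2 P ≤ ENNReal.ofReal B) : ∫ ω, f ω ^ 2 ∂P ≤ B ^ 2 := by
  rw [hf.eLpNorm_eq_integral_rpow_norm (by simp) (by simp)] at h
  rw [ENNReal.ofReal_le_ofReal_iff hB] at h
  simp only [ENNReal.toReal_ofNat, Real.norm_eq_abs, Real.rpow_two, sq_abs] at h
  rw [← one_div, ← Real.sqrt_eq_rpow] at h
  exact (Real.sqrt_le_left hB).1 h

theorem integral_abs_le_sqrt {f : Ω → ℝ} (hf : MemLp f 2 P) {B : ℝ}
    (h : ∫ ω, f ω ^ 2 ∂P ≤ B) : ∫ ω, |f ω| ∂P ≤ √B := by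
  have h1 : eLpNorm f 1 P ≤ ENNReal.ofReal (√B) :=
    (eLpNorm_le_eLpNorm_of_exponent_le (by norm_num) hf.1).trans
      (eLpNorm_two_le_of_integral_sq_le hf h)
  have hi : Integrable f P := hf.integrable (by norm_num)
  rw [eLpNorm_one_eq_lintegral_enorm, ← ofReal_integral_norm_eq_lintegral_enorm hi] at h1
  exact (ENNReal.ofReal_le_ofReal_iff (by positivity)).1 h1

/-- Integrating out a variable that is independent of the others. -/
theorem integral_of_indepFun {𝓧 𝓨 : Type*} [MeasurableSpace 𝓧] [MeasurableSpace 𝓨]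
    {X : Ω → 𝓧} {Y : Ω → 𝓨} (hX : Measurable X) (hY : Measurable Y) (h : IndepFun X Y P)
    {f : 𝓧 → 𝓨 → ℝ} (hf : Measurable (Function.uncurry f))
    (hi : Integrable (fun ω => f (X ω) (Y ω)) P) :
    ∫ ω, f (X ω) (Y ω) ∂P = ∫ ω, (∫ ω', f (X ω') (Y ω) ∂P) ∂P := by
  have := Measure.isProbabilityMeasure_map (μ := P) hX.aemeasurable
  have := Measure.isProbabilityMeasure_map (μ := P) hY.aemeasurable
  have h1 := (indepFun_iff_map_prod_eq_prod_map_map hX.aemeasurable hY.aemeasurable).1 h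
  have hXY : Measurable fun ω => (X ω, Y ω) := hX.prodMk hY
  have hi2 : Integrable (Function.uncurry f) ((P.map X).prod (P.map Y)) := by
    rw [← h1, integrable_map_measure hf.aestronglyMeasurable hXY.aemeasurable]
    exact hi
  calc ∫ ω, f (X ω) (Y ω) ∂P = ∫ w, Function.uncurry f w ∂(P.map (fun ω => (X ω, Y ω))) := by
        rw [integral_map hXY.aemeasurable hf.aestronglyMeasurable]; rfl
    _ = ∫ y, ∫ x, f x y ∂(P.map X) ∂(P.map Y) := by
        rw [h1, integral_prod_symm _ hi2]; rfl
    _ = ∫ ω, (∫ x, f x (Y ω) ∂(P.map X)) ∂P := by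
        rw [integral_map hY.aemeasurable]
        exact (hf.stronglyMeasurable.comp_measurable measurable_swap).integral_prod_right'
          |>.aestronglyMeasurable
    _ = _ := by
        refine integral_congr_ae (Eventually.of_forall fun ω => ?_)
        dsimp only
        rw [integral_map hX.aemeasurable]
        exact (hf.comp (measurable_id.prodMk measurable_const)).aestronglyMeasurable

end Tools

/-! ### Structure of the model -/

namespace IsModel

variable {Ω : Type*} [MeasurableSpace Ω] {P : Measure Ω} [IsProbabilityMeasure P]
  {p : ℕ} {β : Fin p → ℝ} {ν μ : ℝ} {A : ℝ → ℝ} {q : ℝ} {Pi : Measure ℝ} {ε v z ξ : ℤ → Ω → ℝ}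

theorem ae_recursion (hM : IsModel P β ν A q Pi ε v z ξ) (hμ : ν = deltaCoeff β * μ) :
    ∀ᵐ ω ∂P, ∀ t, v t ω - μ = ∑ j : Fin p, β j * (v (t - 1 - (j : ℤ)) ω - μ) + ε t ω := by
  rw [ae_all_iff]
  intro t
  filter_upwards [hM.ar_equation t] with ω h
  rw [h, hμ, deltaCoeff]
  simp only [mul_sub, Finset.sum_sub_distrib, ← Finset.sum_mul]
  ring

theorem ae_z_values (hM : IsModel P β ν A q Pi ε v z ξ) :
    ∀ᵐ ω ∂P, ∀ t, z t ω = 0 ∨ z t ω = 1 :=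
  ae_all_iff.2 hM.z_values

theorem map_sum_shift (hM : IsModel P β ν A q Pi ε v z ξ) (μ : ℝ) (s : Finset ℤ) (T : ℤ) :
    P.map (fun ω => ∑ t ∈ s, (v (t + T) ω - μ)) = P.map (fun ω => ∑ t ∈ s, (v t ω - μ)) := by
  have hg : Measurable fun w : ℤ → ℝ => ∑ t ∈ s, (w t - μ) := by fun_prop
  have := hM.measurable_v
  have h := congrArg (Measure.map (fun w : ℤ → ℝ => ∑ t ∈ s, (w t - μ))) (hM.stationary T)
  rw [Measure.map_map hg (by fun_prop), Measure.map_map hg (by fun_prop)] at h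
  exact h

/-- Finite sums of the stationary solution have a moving-average representation. -/
theorem tendstoInMeasure_sum (hM : IsModel P β ν A q Pi ε v z ξ) (hβ : StableRoots β)
    (hμ : ν = deltaCoeff β * μ) (s : Finset ℤ) :
    TendstoInMeasure P (fun (k : ℕ) ω =>
      ∑ i ∈ Finset.range (k + 1), maCoeff β i * ∑ t ∈ s, ε (t - (i : ℤ)) ω) atTop
      (fun ω => ∑ t ∈ s, (v t ω - μ)) := by
  have hmv := hM.measurable_v
  set w : ℤ → Ω → ℝ := fun T ω => ∑ t ∈ s, (v (t + T) ω - μ) with hw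
  have hwm : ∀ T, Measurable (w T) := fun T => by simp only [hw]; fun_prop
  rw [tendstoInMeasure_iff_norm]
  intro η hη
  -- By stationarity the remote sum `w (-k - 1 - j)` has the law of `w 0`, so it suffices that a
  -- vanishing coefficient times one fixed variable tends to 0 in measure. No moment of v is needed.
  -- The threshold η / (p + 1) leaves room for p summands, also when p = 0.
  have hc : ∀ j : Fin p, Tendsto (fun k => P {ω | η / (p + 1) ≤ ‖remoteCoeff β k j * w 0 ω‖})
      atTop (𝓝 0) := by
    intro j
    have h1 : TendstoInMeasure P (fun k ω => remoteCoeff β k j * w 0 ω) atTop (fun _ => (0 : ℝ)) := by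
      refine tendstoInMeasure_of_tendsto_ae (fun k => ((hwm 0).const_mul _).aestronglyMeasurable)
        (Eventually.of_forall fun ω => ?_)
      simpa using (tendsto_remoteCoeff hβ j).mul_const (w 0 ω)
    rw [tendstoInMeasure_iff_norm] at h1
    simpa using h1 (η / (p + 1)) (by positivity)
  have hsum := tendsto_finsetSum Finset.univ fun j (_ : j ∈ Finset.univ) => hc j
  rw [Finset.sum_const_zero] at hsum
  refine tendsto_of_tendsto_of_tendsto_of_le_of_le tendsto_const_nhds hsum
    (fun _ => bot_le) fun k => ?_
  have hlaw : ∀ j : Fin p, P {ω | η / (p + 1) ≤ ‖remoteCoeff β k j * w 0 ω‖}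
      = P {ω | η / (p + 1) ≤ ‖remoteCoeff β k j * w (0 - k - 1 - (j : ℤ)) ω‖} := by
    intro j
    have hS : MeasurableSet {x : ℝ | η / (p + 1) ≤ ‖remoteCoeff β k j * x‖} :=
      measurableSet_le measurable_const (by fun_prop)
    have h2 := (hM.map_sum_shift μ s (0 - k - 1 - (j : ℤ))).trans (hM.map_sum_shift μ s 0).symm
    have h3 := congrArg (fun m => m {x : ℝ | η / (p + 1) ≤ ‖remoteCoeff β k j * x‖}) h2
    beta_reduce at h3
    rw [Measure.map_apply (hwm _) hS, Measure.map_apply (hwm _) hS] at h3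
    exact h3.symm
  simp only [hlaw]
  refine le_trans (measure_mono_ae ?_) (measure_iUnion_fintype_le P _)
  filter_upwards [hM.ae_recursion hμ] with ω hω hle
  have hrec : ∀ T, w T ω = ∑ j : Fin p, β j * w (T - 1 - (j : ℤ)) ω + ∑ t ∈ s, ε (t + T) ω := by
    intro T
    simp only [hw, Finset.mul_sum]
    rw [Finset.sum_comm, ← Finset.sum_add_distrib]
    refine Finset.sum_congr rfl fun t _ => ?_
    rw [hω (t + T)]
    congr 1
    refine Finset.sum_congr rfl fun j _ => ?_
    rw [show t + T - 1 - (j : ℤ) = t + (T - 1 - j) by ring]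
  have hit := recursion_iterate β (fun T => w T ω) (fun T => ∑ t ∈ s, ε (t + T) ω) hrec 0 k
  have hw0 : w 0 ω = ∑ t ∈ s, (v t ω - μ) := by simp [hw]
  have hle' : η ≤ ‖(∑ i ∈ Finset.range (k + 1), maCoeff β i * ∑ t ∈ s, ε (t - (i : ℤ)) ω)
    - ∑ t ∈ s, (v t ω - μ)‖ := hle
  rw [← hw0, hit] at hle'
  have h4 : ∀ i : ℕ, ∑ t ∈ s, ε (t - (i : ℤ)) ω = ∑ t ∈ s, ε (t + (0 - (i : ℤ))) ω := fun i =>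
    Finset.sum_congr rfl fun t _ => by rw [zero_sub, ← sub_eq_add_neg]
  simp only [h4, sub_add_cancel_left, norm_neg] at hle'
  by_contra hcon
  have h5 : ∀ j : Fin p, ‖remoteCoeff β k j * w (0 - k - 1 - (j : ℤ)) ω‖ < η / (p + 1) := by
    intro j
    by_contra h6
    exact hcon (Set.mem_iUnion.2 ⟨j, not_lt.1 h6⟩)
  have h7 : η ≤ ∑ j : Fin p, η / (p + 1) :=
    hle'.trans ((norm_sum_le _ _).trans (Finset.sum_le_sum fun j _ => (h5 j).le))
  rw [Finset.sum_const, Finset.card_univ, Fintype.card_fin, nsmul_eq_mul] at h7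
  have h8 : (p : ℝ) * (η / (p + 1)) < η := by
    rw [mul_div_assoc', div_lt_iff₀ (by positivity)]; nlinarith
  linarith

/-- The innovation at time `t` is independent of the past of the stationary solution. -/
theorem indepFun_innov_past (hM : IsModel P β ν A q Pi ε v z ξ) (hβ : StableRoots β)
    (hμ : ν = deltaCoeff β * μ) (t : ℤ) :
    IndepFun (ε t) (fun ω (s : ℤ) => if s < t then v s ω else 0) P := by
  have h : ∀ s : ℤ, ∃ ns : ℕ → ℕ, ∀ᵐ ω ∂P, Tendsto (fun k =>
      ∑ i ∈ Finset.range (ns k + 1), maCoeff β i * ε (s - (i : ℤ)) ω) atTop (𝓝 (v s ω - μ)) := by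
    intro s
    obtain ⟨ns, -, h⟩ := (hM.tendstoInMeasure_sum hβ hμ {s}).exists_seq_tendsto_ae
    exact ⟨ns, by simpa using h⟩
  choose ns hns using h
  -- An explicit functional of the innovations before t that recovers v before t almost surely. The
  -- limsup agrees with the limit where it exists and is measurable everywhere.
  let F : (ℤ → ℝ) → ℤ → ℝ := fun e s => if s < t then μ + limsup (fun k =>
      ∑ i ∈ Finset.range (ns s k + 1), maCoeff β i * e (s - (i : ℤ))) atTop else 0
  have hF : Measurable F := by
    refine measurable_pi_lambda _ fun s => ?_
    by_cases hs : s < t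
    · simp only [F, hs, if_true]
      refine measurable_const.add (Measurable.limsup fun k => ?_)
      fun_prop
    · simp only [F, hs, if_false]
      exact measurable_const
  refine ((indepFun_past hM.measurable_innov hM.indep_innov t).comp measurable_id hF).congr
    (Eventually.of_forall fun _ => rfl) ?_
  filter_upwards [ae_all_iff.2 hns] with ω hω
  funext s
  by_cases hs : s < t
  · simp only [F, hs, if_true, Function.comp]
    have h1 : ∀ i : ℕ, (s - (i : ℤ)) < t := fun i => by omega
    simp only [h1, if_true]
    rw [(hω s).limsup_eq]
    ring
  · simp only [F, hs, if_false, Function.comp]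

theorem measurable_path {X : ℤ → Ω → ℝ} (hX : ∀ t, Measurable (X t)) :
    Measurable fun ω (t : ℤ) => X t ω := measurable_pi_lambda _ hX

theorem measurable_past {X : ℤ → Ω → ℝ} (hX : ∀ t, Measurable (X t)) (t : ℤ) :
    Measurable fun ω (s : ℤ) => if s < t then X s ω else 0 := by
  refine measurable_pi_lambda _ fun s => ?_
  by_cases hs : s < t
  · simpa only [hs, if_true] using hX s
  · simp only [hs, if_false]; exact measurable_const

theorem measurable_sequences (hM : IsModel P β ν A q Pi ε v z ξ) (i : Fin 3) :
    Measurable (![fun ω (t : ℤ) => v t ω, fun ω (t : ℤ) => z t ω, fun ω (t : ℤ) => ξ t ω] i) := by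
  fin_cases i
  · exact measurable_path hM.measurable_v
  · exact measurable_path hM.measurable_z
  · exact measurable_path hM.measurable_outlier

theorem indepFun_v_zξ (hM : IsModel P β ν A q Pi ε v z ξ) :
    IndepFun (fun ω (t : ℤ) => v t ω) (fun ω => ((fun t => z t ω), (fun t => ξ t ω)) :
      Ω → (ℤ → ℝ) × (ℤ → ℝ)) P :=
  (hM.indep_sequences.indepFun_prodMk hM.measurable_sequences 1 2 0 (by decide) (by decide)).symm

theorem indepFun_z_ξ (hM : IsModel P β ν A q Pi ε v z ξ) :
    IndepFun (fun ω (t : ℤ) => z t ω) (fun ω (t : ℤ) => ξ t ω) P :=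
  hM.indep_sequences.indepFun (i := 1) (j := 2) (by decide)

/-- The innovation at time `t` is independent of the past of the stationary solution together with
the contamination. -/
theorem indepFun_innov (hM : IsModel P β ν A q Pi ε v z ξ) (hβ : StableRoots β)
    (hμ : ν = deltaCoeff β * μ) (t : ℤ) :
    IndepFun (ε t) (fun ω => ((fun s : ℤ => if s < t then v s ω else 0),
      ((fun t => z t ω), (fun t => ξ t ω))) : Ω → (ℤ → ℝ) × ((ℤ → ℝ) × (ℤ → ℝ))) P := by
  have hmε := hM.measurable_innov
  have hmz := measurable_path hM.measurable_z
  have hmξ := measurable_path hM.measurable_outlier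
  refine indepFun_prodMk_of_indepFun (hM.measurable_innov t) (measurable_past hM.measurable_v t)
    (hmz.prodMk hmξ) (hM.indepFun_innov_past hβ hμ t) ?_
  -- The autoregressive equation makes ε_t a function of the path of v. The pair of ε_t and the past
  -- of v therefore inherits the independence of v from (z, ξ).
  let F : (ℤ → ℝ) → ℝ × (ℤ → ℝ) := fun w =>
    (w t - ∑ j : Fin p, β j * w (t - 1 - (j : ℤ)) - ν, fun s => if s < t then w s else 0)
  have hF : Measurable F := by
    refine Measurable.prodMk (by fun_prop) ?_
    exact measurable_past (X := fun t (w : ℤ → ℝ) => w t) (fun t => measurable_pi_apply t) t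
  refine (hM.indepFun_v_zξ.comp hF measurable_id).congr ?_ (Eventually.of_forall fun _ => rfl)
  filter_upwards [hM.ar_equation t] with ω hω
  simp only [F, Function.comp]
  rw [hω]
  congr 1
  ring

end IsModel

/-! ### Bounds in mean -/

section MeanBounds

variable {Ω : Type*} [MeasurableSpace Ω] {P : Measure Ω} [IsProbabilityMeasure P]

/-- `X` is integrable with `E |X| ≤ B`. -/
def L1Le (P : Measure Ω) (X : Ω → ℝ) (B : ℝ) : Prop := Integrable X P ∧ ∫ ω, |X ω| ∂P ≤ B

namespace L1Le

theorem mono {X : Ω → ℝ} {B C : ℝ} (h : L1Le P X B) (hBC : B ≤ C) : L1Le P X C :=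
  ⟨h.1, h.2.trans hBC⟩

theorem const (c : ℝ) : L1Le P (fun _ => c) |c| := ⟨integrable_const _, by simp⟩

theorem add {X Y : Ω → ℝ} {B C : ℝ} (hX : L1Le P X B) (hY : L1Le P Y C) :
    L1Le P (fun ω => X ω + Y ω) (B + C) := by
  refine ⟨hX.1.add hY.1, ?_⟩
  calc ∫ ω, |X ω + Y ω| ∂P ≤ ∫ ω, (|X ω| + |Y ω|) ∂P :=
        integral_mono (hX.1.add hY.1).abs (hX.1.abs.add hY.1.abs) fun ω => abs_add_le _ _
    _ = ∫ ω, |X ω| ∂P + ∫ ω, |Y ω| ∂P := integral_add hX.1.abs hY.1.abs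
    _ ≤ B + C := add_le_add hX.2 hY.2

theorem const_mul {X : Ω → ℝ} {B : ℝ} (hX : L1Le P X B) (c : ℝ) :
    L1Le P (fun ω => c * X ω) (|c| * B) := by
  refine ⟨hX.1.const_mul c, ?_⟩
  simp only [abs_mul]
  rw [integral_const_mul]
  exact mul_le_mul_of_nonneg_left hX.2 (abs_nonneg c)

theorem abs {X : Ω → ℝ} {B : ℝ} (hX : L1Le P X B) : L1Le P (fun ω => |X ω|) B :=
  ⟨hX.1.abs, by simpa only [abs_abs] using hX.2⟩

theorem sum {ι : Type*} {s : Finset ι} {X : ι → Ω → ℝ} {B : ι → ℝ}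
    (h : ∀ i ∈ s, L1Le P (X i) (B i)) : L1Le P (fun ω => ∑ i ∈ s, X i ω) (∑ i ∈ s, B i) := by
  classical
  induction s using Finset.induction_on with
  | empty => simpa using const (P := P) 0
  | insert a s ha ih =>
    simp only [Finset.sum_insert ha]
    exact (h a (Finset.mem_insert_self a s)).add
      (ih fun i hi => h i (Finset.mem_insert_of_mem hi))

theorem sum_const {ι : Type*} {s : Finset ι} {X : ι → Ω → ℝ} {B : ℝ}
    (h : ∀ i ∈ s, L1Le P (X i) B) : L1Le P (fun ω => ∑ i ∈ s, X i ω) (s.card * B) := by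
  simpa using sum h

theorem of_ae_le {X Y : Ω → ℝ} {B : ℝ} (hY : L1Le P Y B) (hX : AEStronglyMeasurable X P)
    (h : ∀ᵐ ω ∂P, |X ω| ≤ Y ω) : L1Le P X B := by
  have hXi : Integrable X P := hY.1.mono' hX h
  refine ⟨hXi, le_trans (integral_mono_ae hXi.abs hY.1.abs ?_) hY.2⟩
  filter_upwards [h] with ω hω using hω.trans (le_abs_self _)

theorem of_sq {X : Ω → ℝ} {B : ℝ} (hX : MemLp X 2 P) (h : ∫ ω, X ω ^ 2 ∂P ≤ B) :
    L1Le P X (√B) :=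
  ⟨hX.integrable (by norm_num), integral_abs_le_sqrt hX h⟩

/-- Markov's inequality. -/
theorem measure_le {X : Ω → ℝ} {B c : ℝ} (hX : L1Le P X B) (hc : 0 < c) :
    P {ω | c ≤ |X ω|} ≤ ENNReal.ofReal (B / c) := by
  have h := mul_meas_ge_le_integral_of_nonneg (μ := P) (f := fun ω => |X ω|)
    (Eventually.of_forall fun ω => abs_nonneg _) hX.1.abs c
  have h2 : P.real {ω | c ≤ |X ω|} ≤ B / c := by
    rw [le_div_iff₀ hc, mul_comm]; exact h.trans hX.2
  rw [← ofReal_measureReal]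
  exact ENNReal.ofReal_le_ofReal h2

theorem mul_of_indepFun {X Y : Ω → ℝ} {B C : ℝ} (hX : L1Le P X B) (hY : L1Le P Y C)
    (h : IndepFun X Y P) : L1Le P (fun ω => X ω * Y ω) (B * C) := by
  refine ⟨h.integrable_mul hX.1 hY.1, ?_⟩
  simp only [abs_mul]
  have h2 := (h.comp (φ := fun x : ℝ => |x|) (ψ := fun x : ℝ => |x|) (by fun_prop)
    (by fun_prop)).integral_fun_mul_eq_mul_integral hX.1.abs.aestronglyMeasurable
    hY.1.abs.aestronglyMeasurable
  simp only [Function.comp] at h2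
  rw [h2]
  exact mul_le_mul hX.2 hY.2 (integral_nonneg fun _ => abs_nonneg _)
    ((integral_nonneg fun _ => abs_nonneg _).trans hX.2)

end L1Le

end MeanBounds

/-! ### The innovation law -/

/-- A common variance bound for the mixtures of `Q₀` and `Q₁`. -/
noncomputable def innovVar (Q₀ Q₁ : Measure ℝ) : ℝ := ∫ x, x ^ 2 ∂Q₀ + ∫ x, x ^ 2 ∂Q₁

/-- A bound for the second moments of the stationary solution. -/
noncomputable def stationaryVar {p : ℕ} (β : Fin p → ℝ) (Q₀ Q₁ : Measure ℝ) : ℝ :=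
  (∑' k, |maCoeff β k|) ^ 2 * innovVar Q₀ Q₁

theorem innovVar_nonneg (Q₀ Q₁ : Measure ℝ) : 0 ≤ innovVar Q₀ Q₁ :=
  add_nonneg (integral_nonneg fun _ => by positivity) (integral_nonneg fun _ => by positivity)

theorem stationaryVar_nonneg {p : ℕ} (β : Fin p → ℝ) (Q₀ Q₁ : Measure ℝ) :
    0 ≤ stationaryVar β Q₀ Q₁ := mul_nonneg (sq_nonneg _) (innovVar_nonneg _ _)

theorem invSqrt_le_one {n : ℕ} (hn : 1 ≤ n) : (√(n : ℝ))⁻¹ ≤ 1 := by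
  apply inv_le_one_of_one_le₀
  rw [Real.one_le_sqrt]
  exact_mod_cast hn

namespace IsModel

variable {Ω : Type*} [MeasurableSpace Ω] {P : Measure Ω} [IsProbabilityMeasure P]
  {p : ℕ} {β : Fin p → ℝ} {ν μ : ℝ} {n : ℕ} {q : ℝ} {Pi : Measure ℝ} {ε v z ξ : ℤ → Ω → ℝ}
  {Q₀ Q₁ : Measure ℝ} [IsProbabilityMeasure Q₀] [IsProbabilityMeasure Q₁]

/-- A finite measure is determined by its values on half-lines; n ≥ 1 keeps the weight 1 - n^{-1/2}
nonnegative. -/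
theorem map_innov (hM : IsModel P β ν (mixtureCdf Q₀ Q₁ n) q Pi ε v z ξ) (hn : 1 ≤ n) (t : ℤ) :
    P.map (ε t) = ENNReal.ofReal (1 - (√(n : ℝ))⁻¹) • Q₀ + ENNReal.ofReal (√(n : ℝ))⁻¹ • Q₁ := by
  have h0 : 0 ≤ (√(n : ℝ))⁻¹ := by positivity
  have h1 := invSqrt_le_one hn
  have := Measure.isProbabilityMeasure_map (μ := P) (hM.measurable_innov t).aemeasurable
  refine Measure.ext_of_Iic _ _ fun x => ?_
  rw [Measure.map_apply (hM.measurable_innov t) measurableSet_Iic]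
  have h2 : P (ε t ⁻¹' Set.Iic x) = ENNReal.ofReal (mixtureCdf Q₀ Q₁ n x) := by
    rw [← hM.law_innov t x, ofReal_measureReal]; rfl
  rw [h2, mixtureCdf, cdf_eq_real, cdf_eq_real, Measure.add_apply, Measure.smul_apply,
    Measure.smul_apply, smul_eq_mul, smul_eq_mul, ENNReal.ofReal_add
      (mul_nonneg (sub_nonneg.2 h1) measureReal_nonneg) (mul_nonneg h0 measureReal_nonneg),
    ENNReal.ofReal_mul (sub_nonneg.2 h1), ENNReal.ofReal_mul h0, ofReal_measureReal,
    ofReal_measureReal]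

theorem memLp_innov (hM : IsModel P β ν (mixtureCdf Q₀ Q₁ n) q Pi ε v z ξ) (hn : 1 ≤ n)
    (hQ₀ : SmoothCentered Q₀) (hQ₁ : SmoothCentered Q₁) (t : ℤ) : MemLp (ε t) 2 P := by
  have h : MemLp id 2 (P.map (ε t)) := by
    rw [hM.map_innov hn]
    rw [memLp_two_iff_integrable_sq (by fun_prop)]
    exact (hQ₀.finite_variance.integrable_sq.smul_measure ENNReal.ofReal_ne_top).add_measure
      (hQ₁.finite_variance.integrable_sq.smul_measure ENNReal.ofReal_ne_top)
  exact (memLp_map_measure_iff (by fun_prop) (hM.measurable_innov t).aemeasurable).1 h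

theorem integral_comp_innov (hM : IsModel P β ν (mixtureCdf Q₀ Q₁ n) q Pi ε v z ξ) (hn : 1 ≤ n)
    (t : ℤ) {f : ℝ → ℝ} (hf : Measurable f) (h0 : Integrable f Q₀) (h1 : Integrable f Q₁) :
    ∫ ω, f (ε t ω) ∂P = (1 - (√(n : ℝ))⁻¹) * ∫ x, f x ∂Q₀ + (√(n : ℝ))⁻¹ * ∫ x, f x ∂Q₁ := by
  rw [← integral_map (hM.measurable_innov t).aemeasurable hf.aestronglyMeasurable,
    hM.map_innov hn, integral_add_measure (h0.smul_measure ENNReal.ofReal_ne_top)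
      (h1.smul_measure ENNReal.ofReal_ne_top), integral_smul_measure, integral_smul_measure,
    ENNReal.toReal_ofReal (sub_nonneg.2 (invSqrt_le_one hn)),
    ENNReal.toReal_ofReal (by positivity), smul_eq_mul, smul_eq_mul]

theorem integral_innov (hM : IsModel P β ν (mixtureCdf Q₀ Q₁ n) q Pi ε v z ξ) (hn : 1 ≤ n)
    (hQ₀ : SmoothCentered Q₀) (hQ₁ : SmoothCentered Q₁) (t : ℤ) : ∫ ω, ε t ω ∂P = 0 := by
  rw [hM.integral_comp_innov hn t (f := fun x => x) measurable_id (hQ₀.finite_variance.integrable (by norm_num))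
    (hQ₁.finite_variance.integrable (by norm_num))]
  simp [hQ₀.mean_zero, hQ₁.mean_zero]

theorem integral_innov_sq_le (hM : IsModel P β ν (mixtureCdf Q₀ Q₁ n) q Pi ε v z ξ) (hn : 1 ≤ n)
    (hQ₀ : SmoothCentered Q₀) (hQ₁ : SmoothCentered Q₁) (t : ℤ) :
    ∫ ω, ε t ω ^ 2 ∂P ≤ innovVar Q₀ Q₁ := by
  rw [hM.integral_comp_innov hn t (f := fun x => x ^ 2) (by fun_prop)
    hQ₀.finite_variance.integrable_sq hQ₁.finite_variance.integrable_sq, innovVar]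
  have h0 : 0 ≤ (√(n : ℝ))⁻¹ := by positivity
  have h1 := invSqrt_le_one hn
  have h2 : 0 ≤ ∫ x, x ^ 2 ∂Q₀ := integral_nonneg fun _ => by positivity
  have h3 : 0 ≤ ∫ x, x ^ 2 ∂Q₁ := integral_nonneg fun _ => by positivity
  nlinarith

theorem eLpNorm_sum_innov_le (hM : IsModel P β ν (mixtureCdf Q₀ Q₁ n) q Pi ε v z ξ) (hn : 1 ≤ n)
    (hQ₀ : SmoothCentered Q₀) (hQ₁ : SmoothCentered Q₁) (s : Finset ℤ) (i : ℤ) :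
    eLpNorm (fun ω => ∑ t ∈ s, ε (t - i) ω) 2 P
      ≤ ENNReal.ofReal (√(s.card * innovVar Q₀ Q₁)) := by
  have hL := hM.memLp_innov hn hQ₀ hQ₁
  refine eLpNorm_two_le_of_integral_sq_le (memLp_finsetSum s fun t _ => hL (t - i)) ?_
  rw [integral_sq_sum_of_orthogonal s (fun t => ε (t - i)) (fun t _ => hL _) ?_]
  · calc _ ≤ ∑ _t ∈ s, innovVar Q₀ Q₁ :=
          Finset.sum_le_sum fun t _ => hM.integral_innov_sq_le hn hQ₀ hQ₁ _
      _ = _ := by simp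
  · intro t _ r _ htr
    have h := hM.indep_innov.indepFun (i := t - i) (j := r - i) (by omega)
    rw [h.integral_fun_mul_eq_mul_integral (hL _).1 (hL _).1, hM.integral_innov hn hQ₀ hQ₁,
      zero_mul]

/-- At each lag the innovations are orthogonal, which gives √`s.card`; only the lags are added by
Minkowski, at the price of the sum of |`maCoeff β i`|. The bound passes to the limit in measure by
lower semicontinuity of the norm. It yields both the second moment of v and the law of large numbers
for its sums. -/
theorem eLpNorm_sum_le (hM : IsModel P β ν (mixtureCdf Q₀ Q₁ n) q Pi ε v z ξ) (hn : 1 ≤ n)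
    (hQ₀ : SmoothCentered Q₀) (hQ₁ : SmoothCentered Q₁) (hβ : StableRoots β)
    (hμ : ν = deltaCoeff β * μ) (s : Finset ℤ) :
    eLpNorm (fun ω => ∑ t ∈ s, (v t ω - μ)) 2 P
      ≤ ENNReal.ofReal (√(s.card * stationaryVar β Q₀ Q₁)) := by
  have hmε := hM.measurable_innov
  have hS := summable_abs_maCoeff hβ
  refine eLpNorm_le_of_tendstoInMeasure (Eventually.of_forall fun k => ?_)
    (hM.tendstoInMeasure_sum hβ hμ s) fun k => Measurable.aestronglyMeasurable (by fun_prop)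
  have h1 := MeasureTheory.eLpNorm_sum_le (μ := P) (p := 2) (s := Finset.range (k + 1))
    (f := fun (i : ℕ) ω => maCoeff β i * ∑ t ∈ s, ε (t - (i : ℤ)) ω)
    (fun i _ => Measurable.aestronglyMeasurable (by fun_prop)) (by norm_num)
  rw [Finset.sum_fn] at h1
  refine h1.trans ?_
  calc ∑ i ∈ Finset.range (k + 1), eLpNorm (fun ω => maCoeff β i * ∑ t ∈ s, ε (t - (i : ℤ)) ω) 2 P
      ≤ ∑ i ∈ Finset.range (k + 1), ENNReal.ofReal (|maCoeff β i| * √(s.card * innovVar Q₀ Q₁)) := by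
        refine Finset.sum_le_sum fun i _ => ?_
        have h2 := eLpNorm_const_smul (maCoeff β i) (fun ω => ∑ t ∈ s, ε (t - (i : ℤ)) ω) 2 P
        rw [show (fun ω => maCoeff β i * ∑ t ∈ s, ε (t - (i : ℤ)) ω)
          = maCoeff β i • (fun ω => ∑ t ∈ s, ε (t - (i : ℤ)) ω) from rfl, h2,
          ENNReal.ofReal_mul (abs_nonneg _), ← Real.norm_eq_abs, ofReal_norm]
        exact mul_le_mul_right (hM.eLpNorm_sum_innov_le hn hQ₀ hQ₁ s i) _
    _ = ENNReal.ofReal (∑ i ∈ Finset.range (k + 1), |maCoeff β i| * √(s.card * innovVar Q₀ Q₁)) := by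
        rw [ENNReal.ofReal_sum_of_nonneg fun i _ => by positivity]
    _ ≤ _ := by
        apply ENNReal.ofReal_le_ofReal
        rw [← Finset.sum_mul, stationaryVar, mul_left_comm, Real.sqrt_mul (sq_nonneg _),
          Real.sqrt_sq (tsum_nonneg fun _ => abs_nonneg _)]
        gcongr
        exact hS.sum_le_tsum _ fun _ _ => abs_nonneg _

theorem memLp_sum (hM : IsModel P β ν (mixtureCdf Q₀ Q₁ n) q Pi ε v z ξ) (hn : 1 ≤ n)
    (hQ₀ : SmoothCentered Q₀) (hQ₁ : SmoothCentered Q₁) (hβ : StableRoots β)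
    (hμ : ν = deltaCoeff β * μ) (s : Finset ℤ) :
    MemLp (fun ω => ∑ t ∈ s, (v t ω - μ)) 2 P := by
  have := hM.measurable_v
  exact ⟨Measurable.aestronglyMeasurable (by fun_prop),
    (hM.eLpNorm_sum_le hn hQ₀ hQ₁ hβ hμ s).trans_lt ENNReal.ofReal_lt_top⟩

theorem integral_sum_sq_le (hM : IsModel P β ν (mixtureCdf Q₀ Q₁ n) q Pi ε v z ξ) (hn : 1 ≤ n)
    (hQ₀ : SmoothCentered Q₀) (hQ₁ : SmoothCentered Q₁) (hβ : StableRoots β)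
    (hμ : ν = deltaCoeff β * μ) (s : Finset ℤ) :
    ∫ ω, (∑ t ∈ s, (v t ω - μ)) ^ 2 ∂P ≤ s.card * stationaryVar β Q₀ Q₁ := by
  have h := integral_sq_le_of_eLpNorm_two_le (hM.memLp_sum hn hQ₀ hQ₁ hβ hμ s)
    (Real.sqrt_nonneg _) (hM.eLpNorm_sum_le hn hQ₀ hQ₁ hβ hμ s)
  rwa [Real.sq_sqrt (mul_nonneg (Nat.cast_nonneg _) (stationaryVar_nonneg _ _ _))] at h

end IsModel

/-! ### Smoothness of the distribution functions -/

/-- `F` takes values in `[0, 1]`, is Lipschitz with constant `L`, and its first-order Taylor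
remainder is at most `C d²`. -/
structure SmoothBound (F : ℝ → ℝ) (L C : ℝ) : Prop where
  nonneg : ∀ x, 0 ≤ F x
  le_one : ∀ x, F x ≤ 1
  lip : ∀ x y, |F x - F y| ≤ L * |x - y|
  deriv_le : ∀ x, |deriv F x| ≤ L
  taylor : ∀ x d, |F (x + d) - F x - deriv F x * d| ≤ C * d ^ 2
  differentiable : Differentiable ℝ F

theorem SmoothBound.abs_sub_le_one {F : ℝ → ℝ} {L C : ℝ} (h : SmoothBound F L C) (x y : ℝ) :
    |F x - F y| ≤ 1 := by
  have := h.nonneg x; have := h.le_one x; have := h.nonneg y; have := h.le_one y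
  rw [abs_le]; constructor <;> linarith

/-- A function with values in [0, 1] has slope at most 1 in absolute value somewhere on each unit
interval, and |F''| ≤ C lets the slope change by at most C over that distance. Hence |F'| ≤ 1 + C.
-/
theorem SmoothCentered.exists_smoothBound {Q : Measure ℝ} [IsProbabilityMeasure Q]
    (hQ : SmoothCentered Q) : ∃ L C : ℝ, 0 ≤ L ∧ 0 ≤ C ∧ SmoothBound (fun x => cdf Q x) L C := by
  obtain ⟨C, hC⟩ := hQ.bounded_second
  set F : ℝ → ℝ := fun x => cdf Q x with hF
  have hC0 : 0 ≤ C := (abs_nonneg _).trans (hC 0)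
  have hlip : ∀ x y, |deriv F x - deriv F y| ≤ C * |x - y| := fun x y =>
    Convex.norm_image_sub_le_of_norm_deriv_le (fun z _ => hQ.differentiable_deriv z)
      (fun z _ => hC z) convex_univ (Set.mem_univ y) (Set.mem_univ x)
  have hmv : ∀ x d, 0 < d → ∃ y, |y - x| ≤ d ∧ F (x + d) - F x = deriv F y * d := by
    intro x d hd
    obtain ⟨y, hy, hyd⟩ := exists_deriv_eq_slope F (show x < x + d by linarith)
      hQ.differentiable.continuous.continuousOn hQ.differentiable.differentiableOn
    refine ⟨y, ?_, ?_⟩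
    · rw [abs_le]; constructor <;> linarith [hy.1, hy.2]
    · rw [hyd, add_sub_cancel_left, div_mul_cancel₀ _ hd.ne']
  have h01 : ∀ x, 0 ≤ F x ∧ F x ≤ 1 := fun x => ⟨cdf_nonneg Q x, cdf_le_one Q x⟩
  have hd : ∀ x, |deriv F x| ≤ 1 + C := by
    intro x
    obtain ⟨y, hy, hxy⟩ := hmv x 1 one_pos
    have h1 : |deriv F y| ≤ 1 := by
      rw [mul_one] at hxy
      rw [← hxy, abs_le]
      constructor <;> linarith [(h01 x).1, (h01 x).2, (h01 (x + 1)).1, (h01 (x + 1)).2]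
    have h2 := hlip x y
    rw [abs_sub_comm x y] at h2
    have h3 : |deriv F x| ≤ |deriv F x - deriv F y| + |deriv F y| := by
      simpa using abs_add_le (deriv F x - deriv F y) (deriv F y)
    nlinarith
  refine ⟨1 + C, C, by linarith, hC0, fun x => (h01 x).1, fun x => (h01 x).2, fun x y => ?_, hd,
    fun x d => ?_, hQ.differentiable⟩
  · exact Convex.norm_image_sub_le_of_norm_deriv_le (fun z _ => hQ.differentiable z)
      (fun z _ => hd z) convex_univ (Set.mem_univ y) (Set.mem_univ x)
  -- The mean value inequality for e ↦ F(x + e) - F'(x) e, whose derivative is at most C|d| between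
  -- 0 and d; the factor 1/2 of Taylor's formula is not needed.
  · have hder : ∀ e, HasDerivAt (fun e => F (x + e) - deriv F x * e)
        (deriv F (x + e) - deriv F x) e := by
      intro e
      have h1 := (hQ.differentiable (x + e)).hasDerivAt.comp_const_add x e
      have h2 := h1.sub ((hasDerivAt_id e).const_mul (deriv F x))
      rw [mul_one] at h2
      exact h2
    have h2 := Convex.norm_image_sub_le_of_norm_hasDerivWithin_le (s := Set.uIcc 0 d)
      (f := fun e => F (x + e) - deriv F x * e) (C := C * |d|)
      (fun e _ => (hder e).hasDerivWithinAt) (fun e he => ?_) (convex_uIcc 0 d)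
      Set.left_mem_uIcc Set.right_mem_uIcc
    · simp only [add_zero, mul_zero, sub_zero, Real.norm_eq_abs] at h2
      rw [mul_assoc, ← sq, sq_abs] at h2
      rwa [sub_right_comm]
    · refine (hlip (x + e) x).trans ?_
      have h3 : |e| ≤ |d| := by
        have := Set.abs_sub_left_of_mem_uIcc he
        simpa using this
      rw [add_sub_cancel_left]
      gcongr

/-- The constants do not involve the weight `h`, so one pair serves all the mixtures A_n. -/
theorem SmoothBound.convexComb {F G : ℝ → ℝ} {L L' C C' h : ℝ} (hF : SmoothBound F L C)
    (hG : SmoothBound G L' C') (h0 : 0 ≤ h) (h1 : h ≤ 1) :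
    SmoothBound (fun x => (1 - h) * F x + h * G x) (L + L') (C + C') := by
  have hcomb : ∀ a b A B : ℝ, |a| ≤ A → |b| ≤ B → |(1 - h) * a + h * b| ≤ A + B := by
    intro a b A B ha hb
    have hA := (abs_nonneg a).trans ha
    have hB := (abs_nonneg b).trans hb
    calc |(1 - h) * a + h * b| ≤ |(1 - h) * a| + |h * b| := abs_add_le _ _
      _ = (1 - h) * |a| + h * |b| := by
        rw [abs_mul, abs_mul, abs_of_nonneg h0, abs_of_nonneg (sub_nonneg.2 h1)]
      _ ≤ A + B := by nlinarith [abs_nonneg a, abs_nonneg b]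
  have hder : ∀ x, deriv (fun x => (1 - h) * F x + h * G x) x
      = (1 - h) * deriv F x + h * deriv G x := fun x =>
    (((hF.differentiable x).hasDerivAt.const_mul (1 - h)).add
      ((hG.differentiable x).hasDerivAt.const_mul h)).deriv
  refine ⟨fun x => ?_, fun x => ?_, fun x y => ?_, fun x => ?_, fun x d => ?_, ?_⟩
  · exact add_nonneg (mul_nonneg (sub_nonneg.2 h1) (hF.nonneg x)) (mul_nonneg h0 (hG.nonneg x))
  · nlinarith [hF.le_one x, hG.le_one x]
  · have := hcomb _ _ _ _ (hF.lip x y) (hG.lip x y)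
    rw [add_mul]
    convert! this using 2
    ring
  · rw [hder]; exact hcomb _ _ _ _ (hF.deriv_le x) (hG.deriv_le x)
  · have := hcomb _ _ _ _ (hF.taylor x d) (hG.taylor x d)
    rw [hder, add_mul C C']
    convert! this using 2
    ring
  · exact (hF.differentiable.const_mul _).add (hG.differentiable.const_mul _)

/-! ### Pathwise bounds -/

section Pathwise

variable {p : ℕ}

/-- The total effect of the outliers `o` on the residual at time `t`. -/
def shift (β : Fin p → ℝ) (o : ℤ → ℝ) (t : ℤ) : ℝ :=
  ∑ j : Fin (p + 1), Matrix.vecCons (-1) β j * o (t - (j : ℤ))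

/-- The effect on the residual at time `t` of perturbing the parameters by multiples of
`(τ, s)`, widened by `κ`. -/
def pert (τ : ℝ) (s : Fin p → ℝ) (κ : ℝ) (u : ℤ → ℝ) (t : ℤ) : ℝ :=
  τ + ∑ j : Fin p, s j * u (t - 1 - (j : ℤ)) + κ * (1 + ∑ j : Fin p, |u (t - 1 - (j : ℤ))|)

/-- The number of outliers that affect the residual at time `t`. -/
def outlierCount (p : ℕ) (z : ℤ → ℝ) (t : ℤ) : ℝ := ∑ j : Fin (p + 1), z (t - (j : ℤ))

theorem sub_succ_cast (t : ℤ) (j : Fin p) : t - ((j.succ : Fin (p + 1)) : ℤ) = t - 1 - (j : ℤ) := by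
  simp; ring

/-- The dichotomy behind the pathwise estimates: either no outlier touches time t, or an error can
be charged to a count that is at least 1. -/
theorem outlierCount_zero_or {z : ℤ → ℝ} (hz : ∀ t, z t = 0 ∨ z t = 1) (t : ℤ) :
    (outlierCount p z t = 0 ∧ ∀ j : Fin (p + 1), z (t - (j : ℤ)) = 0) ∨ 1 ≤ outlierCount p z t := by
  have h0 : ∀ j ∈ (Finset.univ : Finset (Fin (p + 1))), 0 ≤ z (t - (j : ℤ)) := fun j _ => by
    rcases hz (t - j) with h | h <;> simp [h]
  by_cases h : ∀ j : Fin (p + 1), z (t - (j : ℤ)) = 0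
  · left; exact ⟨by simp [outlierCount, h], h⟩
  · right
    push Not at h
    obtain ⟨j, hj⟩ := h
    have h1 : z (t - (j : ℤ)) = 1 := (hz _).resolve_left hj
    rw [← h1]
    exact Finset.single_le_sum h0 (Finset.mem_univ j)

theorem shift_eq_zero {β : Fin p → ℝ} {z w : ℤ → ℝ} {t : ℤ}
    (h : ∀ j : Fin (p + 1), z (t - (j : ℤ)) = 0) : shift β (fun r => z r * w r) t = 0 := by
  simp [shift, h]

theorem pert_add_eq {τ : ℝ} {s : Fin p → ℝ} {κ : ℝ} {u z w : ℤ → ℝ} {t : ℤ}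
    (h : ∀ j : Fin (p + 1), z (t - (j : ℤ)) = 0) :
    pert τ s κ (fun r => u r + z r * w r) t = pert τ s κ u t := by
  have h' : ∀ j : Fin p, z (t - 1 - (j : ℤ)) = 0 := fun j => by
    rw [← sub_succ_cast]; exact h j.succ
  simp [pert, h']

theorem abs_pert_add_sub_le (τ : ℝ) (s : Fin p → ℝ) (κ : ℝ) (u o : ℤ → ℝ) (t : ℤ) :
    |pert τ s κ (fun r => u r + o r) t - pert τ s κ u t|
      ≤ ∑ j : Fin p, (‖s‖ + |κ|) * |o (t - 1 - (j : ℤ))| := by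
  have h : pert τ s κ (fun r => u r + o r) t - pert τ s κ u t
      = ∑ j : Fin p, (s j * o (t - 1 - (j : ℤ))
        + κ * (|u (t - 1 - (j : ℤ)) + o (t - 1 - (j : ℤ))| - |u (t - 1 - (j : ℤ))|)) := by
    simp only [pert, mul_add, mul_sub, Finset.sum_add_distrib, Finset.sum_sub_distrib,
      Finset.mul_sum]
    ring
  rw [h]
  refine (Finset.abs_sum_le_sum_abs _ _).trans (Finset.sum_le_sum fun j _ => ?_)
  rw [add_mul]
  refine (abs_add_le _ _).trans (add_le_add ?_ ?_)
  · rw [abs_mul]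
    exact mul_le_mul_of_nonneg_right (norm_le_pi_norm s j) (abs_nonneg _)
  · rw [abs_mul]
    refine mul_le_mul_of_nonneg_left ?_ (abs_nonneg _)
    simpa using abs_abs_sub_abs_le (u (t - 1 - (j : ℤ)) + o (t - 1 - (j : ℤ))) (u (t - 1 - (j : ℤ)))

theorem min_one_sum_le {ι : Type*} (s : Finset ι) (f : ι → ℝ) (hf : ∀ i ∈ s, 0 ≤ f i) :
    min 1 (∑ i ∈ s, f i) ≤ ∑ i ∈ s, min 1 (f i) := by
  classical
  by_cases h : ∃ i ∈ s, 1 ≤ f i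
  · obtain ⟨i, hi, h1⟩ := h
    calc min 1 (∑ i ∈ s, f i) ≤ 1 := min_le_left _ _
      _ = min 1 (f i) := (min_eq_left h1).symm
      _ ≤ _ := Finset.single_le_sum (f := fun i => min 1 (f i))
        (fun j hj => le_min zero_le_one (hf j hj)) hi
  · push Not at h
    refine (min_le_right _ _).trans (Finset.sum_le_sum fun i hi => ?_)
    exact le_min (h i hi).le le_rfl

/-- Without outliers near t this is Taylor's estimate. With one, the base point has moved away from
x, so the Lipschitz bound replaces Taylor and costs 2L|h pert|, charged to the outlier count.
Outliers inside the lagged regressors are removed separately; their effect is truncated at 1 because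
they may have no moments. -/
theorem abs_taylor_le {A : ℝ → ℝ} {L C : ℝ} (hA : SmoothBound A L C) (hL : 0 ≤ L) (hC : 0 ≤ C)
    {z w u : ℤ → ℝ}
    (hz : ∀ t, z t = 0 ∨ z t = 1) (β : Fin p → ℝ) (τ : ℝ) (s : Fin p → ℝ) (κ x : ℝ) {h : ℝ}
    (h0 : 0 ≤ h) (t : ℤ) :
    |A (x + shift β (fun r => z r * w r) t + h * pert τ s κ (fun r => u r + z r * w r) t)
      - A (x + shift β (fun r => z r * w r) t) - deriv A x * (h * pert τ s κ u t)|
      ≤ C * (h * pert τ s κ u t) ^ 2 + 2 * L * (outlierCount p z t * |h * pert τ s κ u t|)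
        + ∑ j : Fin p, z (t - 1 - (j : ℤ))
          * min 1 (L * h * (‖s‖ + |κ|) * |w (t - 1 - (j : ℤ))|) := by
  have hz0 : ∀ r, 0 ≤ z r := fun r => by rcases hz r with h | h <;> simp [h]
  have hsum : 0 ≤ ∑ j : Fin p, z (t - 1 - (j : ℤ))
          * min 1 (L * h * (‖s‖ + |κ|) * |w (t - 1 - (j : ℤ))|) :=
    Finset.sum_nonneg fun j _ => mul_nonneg (hz0 _) (le_min zero_le_one (by positivity))
  rcases outlierCount_zero_or (p := p) hz t with ⟨h1, h2⟩ | h1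
  · rw [shift_eq_zero h2, pert_add_eq h2, add_zero, h1, zero_mul, mul_zero, add_zero]
    exact (hA.taylor x _).trans (le_add_of_nonneg_right hsum)
  · set η := shift β (fun r => z r * w r) t
    set e := h * pert τ s κ (fun r => u r + z r * w r) t with he
    set e0 := h * pert τ s κ u t with he0
    have h3 : |A (x + η + e) - A (x + η + e0)| ≤ ∑ j : Fin p, z (t - 1 - (j : ℤ))
          * min 1 (L * h * (‖s‖ + |κ|) * |w (t - 1 - (j : ℤ))|) := by
      have h4 : |A (x + η + e) - A (x + η + e0)| ≤ min 1 (∑ j : Fin p,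
          L * h * (‖s‖ + |κ|) * |z (t - 1 - (j : ℤ)) * w (t - 1 - (j : ℤ))|) := by
        refine le_min (hA.abs_sub_le_one _ _) ((hA.lip _ _).trans ?_)
        have h5 := abs_pert_add_sub_le τ s κ u (fun r => z r * w r) t
        rw [show x + η + e - (x + η + e0) = h * (pert τ s κ (fun r => u r + z r * w r) t
          - pert τ s κ u t) by rw [he, he0]; ring, abs_mul, abs_of_nonneg h0, ← mul_assoc]
        refine (mul_le_mul_of_nonneg_left h5 (mul_nonneg hL h0)).trans (le_of_eq ?_)
        rw [Finset.mul_sum]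
        exact Finset.sum_congr rfl fun j _ => by ring
      refine h4.trans ((min_one_sum_le _ _ fun j _ => by positivity).trans
        (Finset.sum_le_sum fun j _ => ?_))
      rcases hz (t - 1 - j) with h6 | h6 <;> simp [h6]
    have h7 := hA.lip (x + η + e0) (x + η)
    rw [add_sub_cancel_left] at h7
    have h8 : |deriv A x * e0| ≤ L * |e0| := by
      rw [abs_mul]; exact mul_le_mul_of_nonneg_right (hA.deriv_le x) (abs_nonneg _)
    have h9 : |A (x + η + e) - A (x + η) - deriv A x * e0|
        ≤ |A (x + η + e) - A (x + η + e0)| + |A (x + η + e0) - A (x + η)| + |deriv A x * e0| := by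
      rw [show A (x + η + e) - A (x + η) - deriv A x * e0 = (A (x + η + e) - A (x + η + e0))
        + (A (x + η + e0) - A (x + η)) + (-(deriv A x * e0)) by ring]
      refine (abs_add_three _ _ _).trans ?_
      rw [abs_neg]
    have h10 : 2 * L * |e0| ≤ 2 * L * (outlierCount p z t * |e0|) :=
      mul_le_mul_of_nonneg_left (le_mul_of_one_le_left (abs_nonneg _) h1) (by linarith)
    have h11 : 0 ≤ C * e0 ^ 2 := by positivity
    linarith

theorem abs_increment_le {A : ℝ → ℝ} {L C : ℝ} (hA : SmoothBound A L C) (hL : 0 ≤ L)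
    {z w u : ℤ → ℝ} (hz : ∀ t, z t = 0 ∨ z t = 1) (β : Fin p → ℝ) (τ : ℝ) (s : Fin p → ℝ)
    (κ x h : ℝ) (t : ℤ) :
    |A (x + shift β (fun r => z r * w r) t + h * pert τ s κ (fun r => u r + z r * w r) t) - A x|
      ≤ outlierCount p z t + L * |h * pert τ s κ u t| := by
  rcases outlierCount_zero_or (p := p) hz t with ⟨h1, h2⟩ | h1
  · rw [shift_eq_zero h2, pert_add_eq h2, add_zero, h1, zero_add]
    simpa using hA.lip (x + h * pert τ s κ u t) x
  · have h2 := hA.abs_sub_le_one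
      (x + shift β (fun r => z r * w r) t + h * pert τ s κ (fun r => u r + z r * w r) t) x
    have : 0 ≤ L * |h * pert τ s κ u t| := by positivity
    linarith

/-- With no outlier both sides of the comparison vanish. With exactly one, the shift is a single β_j
w and only the passage from A to G costs 2h. With two or more, the trivial bound 1 + (p + 1) is
charged to the number of ordered pairs of outliers, which is then at least 1. -/
theorem abs_shift_decomposition_le {A G : ℝ → ℝ} {h : ℝ} (hA0 : ∀ x, 0 ≤ A x)
    (hA1 : ∀ x, A x ≤ 1) (hG0 : ∀ x, 0 ≤ G x) (hG1 : ∀ x, G x ≤ 1) (hAG : ∀ x, |A x - G x| ≤ h)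
    {z w : ℤ → ℝ} (hz : ∀ t, z t = 0 ∨ z t = 1) (β : Fin p → ℝ) (x : ℝ) (t : ℤ) :
    |A (x + shift β (fun r => z r * w r) t) - A x - ∑ j : Fin (p + 1), z (t - (j : ℤ))
        * (G (x + Matrix.vecCons (-1) β j * w (t - (j : ℤ))) - G x)|
      ≤ 2 * h * outlierCount p z t + (p + 2) * ∑ j : Fin (p + 1), ∑ i : Fin (p + 1),
        if i = j then 0 else z (t - (j : ℤ)) * z (t - (i : ℤ)) := by
  have hh : 0 ≤ h := (abs_nonneg _).trans (hAG 0)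
  have hz0 : ∀ r, 0 ≤ z r := fun r => by rcases hz r with h | h <;> simp [h]
  have hc0 : 0 ≤ outlierCount p z t := Finset.sum_nonneg fun j _ => hz0 _
  have hpair0 : ∀ j i : Fin (p + 1),
      0 ≤ if i = j then 0 else z (t - (j : ℤ)) * z (t - (i : ℤ)) := fun j i => by
    split_ifs; exacts [le_rfl, mul_nonneg (hz0 _) (hz0 _)]
  have hpairs0 : 0 ≤ ∑ j : Fin (p + 1), ∑ i : Fin (p + 1),
        if i = j then 0 else z (t - (j : ℤ)) * z (t - (i : ℤ)) :=
    Finset.sum_nonneg fun j _ => Finset.sum_nonneg fun i _ => hpair0 j i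
  have hp0 : (0 : ℝ) ≤ p + 2 := by positivity
  by_cases h1 : ∀ j : Fin (p + 1), z (t - (j : ℤ)) = 0
  · rw [shift_eq_zero h1]
    simp only [h1, zero_mul, Finset.sum_const_zero, add_zero, sub_self, abs_zero]
    have := mul_nonneg hh hc0
    have := mul_nonneg hp0 hpairs0
    simp only [h1, zero_mul] at this
    linarith
  push Not at h1
  obtain ⟨j, hj⟩ := h1
  have hj1 := (hz _).resolve_left hj
  by_cases h2 : ∀ i : Fin (p + 1), i ≠ j → z (t - (i : ℤ)) = 0
  · have e1 : shift β (fun r => z r * w r) t = Matrix.vecCons (-1) β j * w (t - (j : ℤ)) := by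
      rw [shift, Finset.sum_eq_single j (fun i _ hi => by rw [h2 i hi]; ring) (by simp), hj1]
      ring
    have e2 : ∑ j : Fin (p + 1), z (t - (j : ℤ))
        * (G (x + Matrix.vecCons (-1) β j * w (t - (j : ℤ))) - G x)
        = G (x + Matrix.vecCons (-1) β j * w (t - (j : ℤ))) - G x := by
      rw [Finset.sum_eq_single j (fun i _ hi => by rw [h2 i hi]; ring) (by simp), hj1]
      ring
    have e3 : outlierCount p z t = 1 := by
      rw [outlierCount, Finset.sum_eq_single j (fun i _ hi => h2 i hi) (by simp), hj1]
    rw [e1, e2, e3]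
    set y := x + Matrix.vecCons (-1) β j * w (t - (j : ℤ))
    have h3 : |A y - A x - (G y - G x)| ≤ |A y - G y| + |A x - G x| := by
      rw [show A y - A x - (G y - G x) = (A y - G y) - (A x - G x) by ring]
      exact abs_sub _ _
    have := hAG y; have := hAG x
    have := mul_nonneg hp0 hpairs0
    linarith
  · push Not at h2
    obtain ⟨i, hij, hi⟩ := h2
    have hi1 := (hz _).resolve_left hi
    have h3 : 1 ≤ ∑ j : Fin (p + 1), ∑ i : Fin (p + 1),
        if i = j then 0 else z (t - (j : ℤ)) * z (t - (i : ℤ)) := by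
      calc (1 : ℝ) = if i = j then 0 else z (t - (j : ℤ)) * z (t - (i : ℤ)) := by
            rw [if_neg hij, hj1, hi1, one_mul]
        _ ≤ ∑ i : Fin (p + 1), if i = j then 0 else z (t - (j : ℤ)) * z (t - (i : ℤ)) :=
            Finset.single_le_sum (f := fun i : Fin (p + 1) =>
              if i = j then 0 else z (t - (j : ℤ)) * z (t - (i : ℤ)))
              (fun i _ => hpair0 j i) (Finset.mem_univ i)
        _ ≤ _ := Finset.single_le_sum (f := fun j : Fin (p + 1) => ∑ i : Fin (p + 1),
              if i = j then 0 else z (t - (j : ℤ)) * z (t - (i : ℤ)))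
              (fun j _ => Finset.sum_nonneg fun i _ => hpair0 j i) (Finset.mem_univ j)
    have h4 : |A (x + shift β (fun r => z r * w r) t) - A x| ≤ 1 := by
      rw [abs_le]
      constructor <;> linarith [hA0 x, hA1 x, hA0 (x + shift β (fun r => z r * w r) t),
        hA1 (x + shift β (fun r => z r * w r) t)]
    have h5 : |∑ j : Fin (p + 1), z (t - (j : ℤ))
        * (G (x + Matrix.vecCons (-1) β j * w (t - (j : ℤ))) - G x)| ≤ p + 1 := by
      refine (Finset.abs_sum_le_sum_abs _ _).trans ?_
      calc _ ≤ ∑ _j : Fin (p + 1), (1 : ℝ) := Finset.sum_le_sum fun k _ => ?_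
        _ = p + 1 := by simp
      rw [abs_mul]
      refine mul_le_one₀ ?_ (abs_nonneg _) ?_
      · rcases hz (t - k) with h | h <;> simp [h]
      · rw [abs_le]
        constructor <;> linarith [hG0 x, hG1 x,
          hG0 (x + Matrix.vecCons (-1) β k * w (t - (k : ℤ))),
          hG1 (x + Matrix.vecCons (-1) β k * w (t - (k : ℤ)))]
    have h6 := abs_sub (A (x + shift β (fun r => z r * w r) t) - A x)
      (∑ j : Fin (p + 1), z (t - (j : ℤ))
        * (G (x + Matrix.vecCons (-1) β j * w (t - (j : ℤ))) - G x))
    have h7 := mul_le_mul_of_nonneg_left h3 hp0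
    have h8 := mul_nonneg hh hc0
    linarith

/-- The residual in terms of the innovation, the outliers and the parameter errors. -/
theorem residual_le_iff {β b : Fin p → ℝ} {μ m h : ℝ} (hh : 0 < h) {v z w e : ℤ → ℝ} {t : ℤ}
    (hrec : v t - μ = ∑ j : Fin p, β j * (v (t - 1 - (j : ℤ)) - μ) + e t) (x : ℝ) :
    residual m b (fun r => v r + z r * w r) t ≤ x ↔
      e t ≤ x + shift β (fun r => z r * w r) t
        + h * pert (h⁻¹ * (m - μ) * (1 - ∑ j, b j)) (fun j => h⁻¹ * (b j - β j)) 0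
          (fun r => v r - μ + z r * w r) t := by
  -- An exact identity: the error in the centre enters through (m - μ)(1 - ∑ b_j), and the error b -
  -- β multiplies the contaminated deviations from μ.
  have key : residual m b (fun r => v r + z r * w r) t = e t - shift β (fun r => z r * w r) t
      - h * pert (h⁻¹ * (m - μ) * (1 - ∑ j, b j)) (fun j => h⁻¹ * (b j - β j)) 0
          (fun r => v r - μ + z r * w r) t := by
    rw [residual, shift, Fin.sum_univ_succ, pert, zero_mul, add_zero]
    simp only [Matrix.cons_val_zero, Matrix.cons_val_succ, sub_succ_cast,
      Fin.val_zero, Nat.cast_zero, sub_zero, mul_add, Finset.mul_sum]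
    have e1 : h * (h⁻¹ * (m - μ) * (1 - ∑ j, b j)) = (m - μ) - ∑ j, b j * (m - μ) := by
      rw [← Finset.sum_mul]; field_simp
    have e2 : ∀ j : Fin p, h * (h⁻¹ * (b j - β j) * (v (t - 1 - (j : ℤ)) - μ
        + z (t - 1 - (j : ℤ)) * w (t - 1 - (j : ℤ)))) = (b j - β j) * (v (t - 1 - (j : ℤ)) - μ
        + z (t - 1 - (j : ℤ)) * w (t - 1 - (j : ℤ))) := fun j => by field_simp
    have e3 : v t = μ + ∑ j : Fin p, β j * (v (t - 1 - (j : ℤ)) - μ) + e t := by linarith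
    simp only [mul_add] at e2
    rw [e1]
    simp only [← mul_add] at e2 ⊢
    simp only [e2]
    rw [e3]
    have e4 : ∑ j, b j * (v (t - 1 - (j : ℤ)) + z (t - 1 - (j : ℤ)) * w (t - 1 - (j : ℤ)) - m)
        = ∑ j : Fin p, β j * (v (t - 1 - (j : ℤ)) - μ)
          + ∑ j : Fin p, β j * (z (t - 1 - (j : ℤ)) * w (t - 1 - (j : ℤ)))
          - ∑ j, b j * (m - μ) + ∑ j : Fin p, (b j - β j) * (v (t - 1 - (j : ℤ)) - μ
        + z (t - 1 - (j : ℤ)) * w (t - 1 - (j : ℤ))) := by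
      rw [← Finset.sum_add_distrib, ← Finset.sum_sub_distrib, ← Finset.sum_add_distrib]
      exact Finset.sum_congr rfl fun j _ => by ring
    rw [e4]
    ring
  rw [key]
  constructor <;> intro h' <;> linarith

/-- Nearby parameters give perturbations between the widened ones. -/
theorem abs_pert_sub_le {τ τ' : ℝ} {s s' : Fin p → ℝ} {κ : ℝ} (h1 : |τ - τ'| ≤ κ)
    (h2 : ‖s - s'‖ ≤ κ) (u : ℤ → ℝ) (t : ℤ) :
    pert τ' s' (-κ) u t ≤ pert τ s 0 u t ∧ pert τ s 0 u t ≤ pert τ' s' κ u t := by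
  have h3 : |∑ j : Fin p, s j * u (t - 1 - (j : ℤ)) - ∑ j : Fin p, s' j * u (t - 1 - (j : ℤ))|
      ≤ κ * ∑ j : Fin p, |u (t - 1 - (j : ℤ))| := by
    rw [← Finset.sum_sub_distrib, Finset.mul_sum]
    refine (Finset.abs_sum_le_sum_abs _ _).trans (Finset.sum_le_sum fun j _ => ?_)
    rw [← sub_mul, abs_mul]
    exact mul_le_mul_of_nonneg_right ((norm_le_pi_norm (s - s') j).trans h2) (abs_nonneg _)
  rw [abs_le] at h1 h3
  simp only [pert, zero_mul, add_zero]
  constructor <;> linarith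

end Pathwise

/-! ### The martingale part -/

/-- The indicator of `e ≤ x`. -/
noncomputable def step (x e : ℝ) : ℝ := (Set.Iic x).indicator (fun _ => (1 : ℝ)) e

theorem step_eq (x e : ℝ) : step x e = if e ≤ x then 1 else 0 := by
  simp [step, Set.indicator]

theorem step_nonneg (x e : ℝ) : 0 ≤ step x e := by rw [step_eq]; split_ifs <;> norm_num

theorem step_le_one (x e : ℝ) : step x e ≤ 1 := by rw [step_eq]; split_ifs <;> norm_num

theorem step_mono {x y : ℝ} (h : x ≤ y) (e : ℝ) : step x e ≤ step y e := by
  rw [step_eq, step_eq]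
  split_ifs with h1 h2 <;> linarith

theorem measurable_step : Measurable (Function.uncurry step) := by
  have : Function.uncurry step = fun w : ℝ × ℝ => if w.2 ≤ w.1 then (1 : ℝ) else 0 := by
    funext w; exact step_eq _ _
  rw [this]
  exact Measurable.ite (measurableSet_le measurable_snd measurable_fst) measurable_const
    measurable_const

/-- The centred increment of the indicator process. -/
noncomputable def centredStep (A : ℝ → ℝ) (x e d : ℝ) : ℝ :=
  step (x + d) e - step x e - (A (x + d) - A x)

theorem measurable_centredStep {A : ℝ → ℝ} (hA : Measurable A) (x : ℝ) :
    Measurable fun w : ℝ × ℝ => centredStep A x w.1 w.2 := by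
  have h1 : Measurable fun w : ℝ × ℝ => step (x + w.2) w.1 :=
    measurable_step.comp ((measurable_snd.const_add x).prodMk measurable_fst)
  have h2 : Measurable fun w : ℝ × ℝ => step x w.1 :=
    measurable_step.comp (measurable_const.prodMk measurable_fst)
  have h3 : Measurable fun w : ℝ × ℝ => A (x + w.2) := hA.comp (measurable_snd.const_add x)
  exact (h1.sub h2).sub (h3.sub measurable_const)

/-- The increment has a constant sign in `e`, so its mean absolute value is simply the increment of
the distribution function. -/
theorem abs_step_sub (x d e : ℝ) : |step (x + d) e - step x e| =
    if 0 ≤ d then step (x + d) e - step x e else step x e - step (x + d) e := by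
  split_ifs with h
  · rw [abs_of_nonneg (sub_nonneg.2 (step_mono (by linarith) e))]
  · rw [abs_sub_comm, abs_of_nonneg (sub_nonneg.2 (step_mono (by linarith) e))]

namespace IsModel

variable {Ω : Type*} [MeasurableSpace Ω] {P : Measure Ω} [IsProbabilityMeasure P]
  {p : ℕ} {β : Fin p → ℝ} {ν μ : ℝ} {A : ℝ → ℝ} {q : ℝ} {Pi : Measure ℝ} {ε v z ξ : ℤ → Ω → ℝ}

theorem integral_step (hM : IsModel P β ν A q Pi ε v z ξ) (t : ℤ) (x : ℝ) :
    ∫ ω, step x (ε t ω) ∂P = A x := by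
  have h : (fun ω => step x (ε t ω)) = {ω | ε t ω ≤ x}.indicator fun _ => (1 : ℝ) := by
    funext ω; simp [step, Set.indicator]
  rw [h, integral_indicator_const _ (measurableSet_le (hM.measurable_innov t) measurable_const),
    hM.law_innov t x]
  simp

theorem integrable_step (hM : IsModel P β ν A q Pi ε v z ξ) (t : ℤ) (x : ℝ) :
    Integrable (fun ω => step x (ε t ω)) P := by
  refine Integrable.of_bound (C := 1) ?_ (Eventually.of_forall fun ω => ?_)
  · exact (measurable_step.comp (measurable_const.prodMk (hM.measurable_innov t))).aestronglyMeasurable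
  · rw [Real.norm_eq_abs, abs_of_nonneg (step_nonneg _ _)]
    exact step_le_one _ _

theorem cdf_mem (hM : IsModel P β ν A q Pi ε v z ξ) (x : ℝ) : 0 ≤ A x ∧ A x ≤ 1 := by
  rw [← hM.law_innov 0 x]
  exact ⟨measureReal_nonneg, measureReal_le_one⟩

theorem abs_centredStep_le (hM : IsModel P β ν A q Pi ε v z ξ) (x e d : ℝ) :
    |centredStep A x e d| ≤ 2 := by
  have := hM.cdf_mem x; have := hM.cdf_mem (x + d)
  have := step_nonneg x e; have := step_nonneg (x + d) e
  have := step_le_one x e; have := step_le_one (x + d) e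
  rw [centredStep, abs_le]
  constructor <;> linarith

theorem integral_centredStep (hM : IsModel P β ν A q Pi ε v z ξ) (t : ℤ) (x d : ℝ) :
    ∫ ω, centredStep A x (ε t ω) d ∂P = 0 := by
  simp only [centredStep]
  rw [integral_sub (f := fun ω => step (x + d) (ε t ω) - step x (ε t ω))
      ((hM.integrable_step t _).sub (hM.integrable_step t _)) (integrable_const _),
    integral_sub (hM.integrable_step t _) (hM.integrable_step t _), hM.integral_step,
    hM.integral_step]
  simp

theorem integral_abs_step_sub (hM : IsModel P β ν A q Pi ε v z ξ) (t : ℤ) (x d : ℝ) :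
    ∫ ω, |step (x + d) (ε t ω) - step x (ε t ω)| ∂P ≤ |A (x + d) - A x| := by
  simp only [abs_step_sub]
  split_ifs
  · rw [integral_sub (hM.integrable_step t _) (hM.integrable_step t _), hM.integral_step,
      hM.integral_step]
    exact le_abs_self _
  · rw [integral_sub (hM.integrable_step t _) (hM.integrable_step t _), hM.integral_step,
      hM.integral_step]
    rw [abs_sub_comm]
    exact le_abs_self _

/-- The sample path of the three sequences. -/
def path (v z ξ : ℤ → Ω → ℝ) (ω : Ω) : (ℤ → ℝ) × ((ℤ → ℝ) × (ℤ → ℝ)) :=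
  (fun t => v t ω, (fun t => z t ω, fun t => ξ t ω))

theorem measurable_path_prod (hM : IsModel P β ν A q Pi ε v z ξ) : Measurable (path v z ξ) :=
  (measurable_path hM.measurable_v).prodMk
    ((measurable_path hM.measurable_z).prodMk (measurable_path hM.measurable_outlier))

variable {D : ℤ → (ℤ → ℝ) × ((ℤ → ℝ) × (ℤ → ℝ)) → ℝ}

theorem measurable_centredStep_path (hM : IsModel P β ν A q Pi ε v z ξ) (hA : Measurable A)
    (hD : ∀ t, Measurable (D t)) (x : ℝ) (t : ℤ) :
    Measurable fun ω => centredStep A x (ε t ω) (D t (path v z ξ ω)) :=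
  (measurable_centredStep hA x).comp
    ((hM.measurable_innov t).prodMk ((hD t).comp hM.measurable_path_prod))

/-- Martingale orthogonality: given the past of v before t and the whole of z and ξ, the earlier
factor is fixed and the later one has mean zero. Looking ahead in z and ξ is harmless since ε_t is
independent of them. -/
theorem integral_centredStep_mul (hM : IsModel P β ν A q Pi ε v z ξ) (hβ : StableRoots β)
    (hμ : ν = deltaCoeff β * μ) (hA : Measurable A) (hD : ∀ t, Measurable (D t))
    (hDp : ∀ t w w' y, (∀ r < t, w r = w' r) → D t (w, y) = D t (w', y)) (x : ℝ) {s t : ℤ}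
    (hst : s < t) :
    ∫ ω, centredStep A x (ε s ω) (D s (path v z ξ ω))
      * centredStep A x (ε t ω) (D t (path v z ξ ω)) ∂P = 0 := by
  let Y : Ω → (ℤ → ℝ) × ((ℤ → ℝ) × (ℤ → ℝ)) := fun ω =>
    ((fun s : ℤ => if s < t then v s ω else 0), ((fun t => z t ω), (fun t => ξ t ω)))
  have hY : Measurable Y := (measurable_past hM.measurable_v t).prodMk
    ((measurable_path hM.measurable_z).prodMk (measurable_path hM.measurable_outlier))
  have hDY : ∀ r ≤ t, ∀ ω, D r (path v z ξ ω) = D r (Y ω) := fun r hr ω =>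
    hDp r _ _ _ fun i hi => by simp [show i < t by omega]
  -- The innovation ε_s is rewritten through the autoregressive equation, which makes the factor at
  -- time s a function of the past at time t.
  let G : (ℤ → ℝ) × ((ℤ → ℝ) × (ℤ → ℝ)) → ℝ := fun y =>
    centredStep A x (y.1 s - ∑ j : Fin p, β j * y.1 (s - 1 - (j : ℤ)) - ν) (D s y)
  have hG : Measurable G := by
    refine (measurable_centredStep hA x).comp (Measurable.prodMk ?_ (hD s))
    fun_prop
  let f : ℝ → (ℤ → ℝ) × ((ℤ → ℝ) × (ℤ → ℝ)) → ℝ := fun e y => G y * centredStep A x e (D t y)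
  have hf : Measurable (Function.uncurry f) :=
    (hG.comp measurable_snd).mul ((measurable_centredStep hA x).comp
      (measurable_fst.prodMk ((hD t).comp measurable_snd)))
  have hfb : ∀ e y, |f e y| ≤ 2 * 2 := fun e y => by
    simp only [f, abs_mul]
    exact mul_le_mul (hM.abs_centredStep_le _ _ _) (hM.abs_centredStep_le _ _ _) (abs_nonneg _)
      (by norm_num)
  have hae : (fun ω => centredStep A x (ε s ω) (D s (path v z ξ ω))
      * centredStep A x (ε t ω) (D t (path v z ξ ω))) =ᵐ[P] fun ω => f (ε t ω) (Y ω) := by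
    filter_upwards [hM.ar_equation s] with ω hω
    simp only [f, G]
    rw [hDY s hst.le, hDY t le_rfl]
    congr 2
    have h1 : ∀ j : Fin p, s - 1 - (j : ℤ) < t := fun j => by omega
    simp only [Y, hst, h1, if_true]
    rw [hω]; ring
  rw [integral_congr_ae hae, integral_of_indepFun (hM.measurable_innov t) hY
    (hM.indepFun_innov hβ hμ t) hf]
  · simp only [f, integral_const_mul, hM.integral_centredStep, mul_zero, integral_zero]
  · exact Integrable.of_bound (C := 2 * 2) (hf.comp ((hM.measurable_innov t).prodMk hY)).aestronglyMeasurable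
      (Eventually.of_forall fun ω => hfb _ _)

/-- Both the indicator increment and its compensator are bounded by 1, so their squares are at most
their absolute values, and each of these has mean at most B. The second moment is thus of first
order in the size of the increment. -/
theorem integral_centredStep_sq_le (hM : IsModel P β ν A q Pi ε v z ξ) (hβ : StableRoots β)
    (hμ : ν = deltaCoeff β * μ) (hD : ∀ t, Measurable (D t))
    (hDp : ∀ t w w' y, (∀ r < t, w r = w' r) → D t (w, y) = D t (w', y)) (x : ℝ) (t : ℤ)
    {B : ℝ} (hB : L1Le P (fun ω => A (x + D t (path v z ξ ω)) - A x) B) :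
    ∫ ω, centredStep A x (ε t ω) (D t (path v z ξ ω)) ^ 2 ∂P ≤ 4 * B := by
  let Y : Ω → (ℤ → ℝ) × ((ℤ → ℝ) × (ℤ → ℝ)) := fun ω =>
    ((fun s : ℤ => if s < t then v s ω else 0), ((fun t => z t ω), (fun t => ξ t ω)))
  have hY : Measurable Y := (measurable_past hM.measurable_v t).prodMk
    ((measurable_path hM.measurable_z).prodMk (measurable_path hM.measurable_outlier))
  have hDY : ∀ ω, D t (path v z ξ ω) = D t (Y ω) := fun ω =>
    hDp t _ _ _ fun i hi => by simp [hi]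
  simp only [hDY] at hB ⊢
  let f : ℝ → (ℤ → ℝ) × ((ℤ → ℝ) × (ℤ → ℝ)) → ℝ := fun e y =>
    |step (x + D t y) e - step x e|
  have hf : Measurable (Function.uncurry f) := by
    have h1 : Measurable fun w : ℝ × ((ℤ → ℝ) × ((ℤ → ℝ) × (ℤ → ℝ))) => step (x + D t w.2) w.1 :=
      measurable_step.comp ((((hD t).comp measurable_snd).const_add x).prodMk measurable_fst)
    have h2 : Measurable fun w : ℝ × ((ℤ → ℝ) × ((ℤ → ℝ) × (ℤ → ℝ))) => step x w.1 :=
      measurable_step.comp (measurable_const.prodMk measurable_fst)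
    exact continuous_abs.measurable.comp (h1.sub h2)
  have hf1 : ∀ e y, f e y ≤ 1 := fun e y => by
    have := step_nonneg x e; have := step_nonneg (x + D t y) e
    have := step_le_one x e; have := step_le_one (x + D t y) e
    simp only [f]
    rw [abs_le]; constructor <;> linarith
  have hfi : Integrable (fun ω => f (ε t ω) (Y ω)) P :=
    Integrable.of_bound (C := 1) (hf.comp ((hM.measurable_innov t).prodMk hY)).aestronglyMeasurable
      (Eventually.of_forall fun ω => by
        rw [Real.norm_eq_abs, abs_abs]; exact hf1 _ _)
  have h1 : ∫ ω, f (ε t ω) (Y ω) ∂P ≤ B := by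
    rw [integral_of_indepFun (hM.measurable_innov t) hY (hM.indepFun_innov hβ hμ t) hf hfi]
    refine le_trans (integral_mono_of_nonneg (Eventually.of_forall fun ω =>
      integral_nonneg fun _ => abs_nonneg _) hB.1.abs (Eventually.of_forall fun ω => ?_)) hB.2
    exact hM.integral_abs_step_sub t x _
  have h2 : ∀ ω, centredStep A x (ε t ω) (D t (Y ω)) ^ 2
      ≤ 2 * f (ε t ω) (Y ω) + 2 * |A (x + D t (Y ω)) - A x| := by
    intro ω
    have h3 : |A (x + D t (Y ω)) - A x| ≤ 1 := by
      have := hM.cdf_mem x; have := hM.cdf_mem (x + D t (Y ω))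
      rw [abs_le]; constructor <;> linarith
    have h4 := hf1 (ε t ω) (Y ω)
    have h5 : 0 ≤ f (ε t ω) (Y ω) := abs_nonneg _
    have h6 : (step (x + D t (Y ω)) (ε t ω) - step x (ε t ω)) ^ 2 = f (ε t ω) (Y ω) ^ 2 :=
      (sq_abs _).symm
    have h7 := sq_abs (A (x + D t (Y ω)) - A x)
    have h8 := abs_nonneg (A (x + D t (Y ω)) - A x)
    rw [centredStep]
    nlinarith [sq_nonneg (step (x + D t (Y ω)) (ε t ω) - step x (ε t ω)
      + (A (x + D t (Y ω)) - A x))]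
  calc _ ≤ ∫ ω, (2 * f (ε t ω) (Y ω) + 2 * |A (x + D t (Y ω)) - A x|) ∂P :=
        integral_mono_of_nonneg (Eventually.of_forall fun ω => sq_nonneg _)
          ((hfi.const_mul 2).add (hB.1.abs.const_mul 2)) (Eventually.of_forall h2)
    _ = 2 * ∫ ω, f (ε t ω) (Y ω) ∂P + 2 * ∫ ω, |A (x + D t (Y ω)) - A x| ∂P := by
        rw [integral_add (hfi.const_mul 2) (hB.1.abs.const_mul 2), integral_const_mul,
          integral_const_mul]
    _ ≤ 4 * B := by linarith [hB.2]

theorem l1Le_sum_centredStep (hM : IsModel P β ν A q Pi ε v z ξ) (hβ : StableRoots β)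
    (hμ : ν = deltaCoeff β * μ) (hA : Measurable A) (hD : ∀ t, Measurable (D t))
    (hDp : ∀ t w w' y, (∀ r < t, w r = w' r) → D t (w, y) = D t (w', y)) (x : ℝ) (s : Finset ℤ)
    {B : ℝ} (hB : ∀ t ∈ s, L1Le P (fun ω => A (x + D t (path v z ξ ω)) - A x) B) :
    L1Le P (fun ω => ∑ t ∈ s, centredStep A x (ε t ω) (D t (path v z ξ ω)))
      (√(s.card * (4 * B))) := by
  have hL : ∀ t, MemLp (fun ω => centredStep A x (ε t ω) (D t (path v z ξ ω))) 2 P := fun t =>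
    MemLp.of_bound (hM.measurable_centredStep_path hA hD x t).aestronglyMeasurable 2
      (Eventually.of_forall fun ω => hM.abs_centredStep_le _ _ _)
  refine L1Le.of_sq (memLp_finsetSum s fun t _ => hL t) ?_
  rw [integral_sq_sum_of_orthogonal s _ fun t _ => hL t]
  · calc _ ≤ ∑ _t ∈ s, 4 * B := Finset.sum_le_sum fun t ht =>
          hM.integral_centredStep_sq_le hβ hμ hD hDp x t (hB t ht)
      _ = _ := by simp
  · intro r _ t _ hrt
    rcases lt_or_gt_of_ne hrt with h | h
    · exact hM.integral_centredStep_mul hβ hμ hA hD hDp x h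
    · rw [← hM.integral_centredStep_mul hβ hμ hA hD hDp x h]
      simp only [mul_comm]

end IsModel

/-! ### Mean bounds for the compensator -/

/-- Bound for the second moment of `pert`, when the stationary solution has second moment `≤ K`. -/
noncomputable def pertVar {p : ℕ} (τ : ℝ) (s : Fin p → ℝ) (κ K : ℝ) : ℝ :=
  2 * (|τ| + |κ|) ^ 2 + 2 * (‖s‖ + |κ|) ^ 2 * (p * (p * K))

theorem abs_pert_le {p : ℕ} (τ : ℝ) (s : Fin p → ℝ) (κ : ℝ) (u : ℤ → ℝ) (t : ℤ) :
    |pert τ s κ u t| ≤ (|τ| + |κ|) + (‖s‖ + |κ|) * ∑ j : Fin p, |u (t - 1 - (j : ℤ))| := by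
  have h1 : |∑ j : Fin p, s j * u (t - 1 - (j : ℤ))| ≤ ‖s‖ * ∑ j : Fin p, |u (t - 1 - (j : ℤ))| := by
    rw [Finset.mul_sum]
    refine (Finset.abs_sum_le_sum_abs _ _).trans (Finset.sum_le_sum fun j _ => ?_)
    rw [abs_mul]
    exact mul_le_mul_of_nonneg_right (norm_le_pi_norm s j) (abs_nonneg _)
  have h2 : 0 ≤ 1 + ∑ j : Fin p, |u (t - 1 - (j : ℤ))| := by positivity
  have h3 := abs_add_three τ (∑ j : Fin p, s j * u (t - 1 - (j : ℤ)))
    (κ * (1 + ∑ j : Fin p, |u (t - 1 - (j : ℤ))|))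
  rw [abs_mul, abs_of_nonneg h2] at h3
  rw [pert]
  linarith

theorem pert_sq_le {p : ℕ} (τ : ℝ) (s : Fin p → ℝ) (κ : ℝ) (u : ℤ → ℝ) (t : ℤ) :
    pert τ s κ u t ^ 2 ≤ 2 * (|τ| + |κ|) ^ 2
      + 2 * (‖s‖ + |κ|) ^ 2 * (p * ∑ j : Fin p, u (t - 1 - (j : ℤ)) ^ 2) := by
  have h1 := abs_pert_le τ s κ u t
  have h2 : (∑ j : Fin p, |u (t - 1 - (j : ℤ))|) ^ 2 ≤ p * ∑ j : Fin p, u (t - 1 - (j : ℤ)) ^ 2 := by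
    have := sq_sum_le_card_mul_sum_sq (s := Finset.univ)
      (f := fun j : Fin p => |u (t - 1 - (j : ℤ))|)
    simpa using this
  have h3 : pert τ s κ u t ^ 2
      ≤ ((|τ| + |κ|) + (‖s‖ + |κ|) * ∑ j : Fin p, |u (t - 1 - (j : ℤ))|) ^ 2 := by
    rw [← sq_abs]
    exact pow_le_pow_left₀ (abs_nonneg _) h1 2
  have h4 := mul_le_mul_of_nonneg_left h2 (sq_nonneg (‖s‖ + |κ|))
  nlinarith [sq_nonneg ((|τ| + |κ|) - (‖s‖ + |κ|) * ∑ j : Fin p, |u (t - 1 - (j : ℤ))|)]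

namespace IsModel

variable {Ω : Type*} [MeasurableSpace Ω] {P : Measure Ω} [IsProbabilityMeasure P]
  {p : ℕ} {β : Fin p → ℝ} {ν μ : ℝ} {A : ℝ → ℝ} {q : ℝ} {Pi : Measure ℝ} {ε v z ξ : ℤ → Ω → ℝ}

/-! ### Moments of the contamination indicators and outliers -/

section Contamination

theorem integral_z (hM : IsModel P β ν A q Pi ε v z ξ) (t : ℤ) : ∫ ω, z t ω ∂P = q := by
  have h : z t =ᵐ[P] {ω | z t ω = 1}.indicator fun _ => (1 : ℝ) := by
    filter_upwards [hM.z_values t] with ω hω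
    rcases hω with h | h <;> simp [Set.indicator, h]
  rw [integral_congr_ae h, integral_indicator_const _
    (measurableSet_eq_fun (hM.measurable_z t) measurable_const), hM.z_prob]
  simp

theorem l1Le_z (hM : IsModel P β ν A q Pi ε v z ξ) (t : ℤ) : L1Le P (z t) q := by
  have h0 : ∀ᵐ ω ∂P, 0 ≤ z t ω ∧ |z t ω| ≤ 1 := by
    filter_upwards [hM.z_values t] with ω hω
    rcases hω with h | h <;> simp [h]
  refine ⟨Integrable.of_bound (C := 1) (hM.measurable_z t).aestronglyMeasurable
    (h0.mono fun ω h => h.2), le_of_eq ?_⟩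
  rw [← hM.integral_z t]
  exact integral_congr_ae (h0.mono fun ω h => abs_of_nonneg h.1)

theorem l1Le_outlierCount (hM : IsModel P β ν A q Pi ε v z ξ) (t : ℤ) :
    L1Le P (fun ω => outlierCount p (fun r => z r ω) t) ((p + 1) * q) := by
  have := L1Le.sum_const (s := (Finset.univ : Finset (Fin (p + 1))))
    fun j _ => hM.l1Le_z (t - (j : ℤ))
  simpa [outlierCount] using this

/-- Indicators at distinct times are independent, so pairs of outliers have frequency of order q².
-/
theorem l1Le_pairs (hM : IsModel P β ν A q Pi ε v z ξ) (t : ℤ) :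
    L1Le P (fun ω => ∑ j : Fin (p + 1), ∑ i : Fin (p + 1),
      if i = j then 0 else z (t - (j : ℤ)) ω * z (t - (i : ℤ)) ω) ((p + 1) * ((p + 1) * q ^ 2)) := by
  have h : ∀ j i : Fin (p + 1), L1Le P (fun ω =>
      if i = j then 0 else z (t - (j : ℤ)) ω * z (t - (i : ℤ)) ω) (q ^ 2) := by
    intro j i
    split_ifs with hij
    · exact (L1Le.const 0).mono (by simpa using sq_nonneg q)
    · have hne : t - (j : ℤ) ≠ t - (i : ℤ) := fun h => hij (Fin.ext (by omega))
      rw [sq]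
      exact (hM.l1Le_z _).mul_of_indepFun (hM.l1Le_z _) (hM.indep_z.indepFun hne)
  have := L1Le.sum_const (s := (Finset.univ : Finset (Fin (p + 1)))) fun j _ =>
    L1Le.sum_const (s := (Finset.univ : Finset (Fin (p + 1)))) fun i _ => h j i
  simpa using this

theorem l1Le_z_mul_outlier (hM : IsModel P β ν A q Pi ε v z ξ) [IsProbabilityMeasure Pi] (t : ℤ)
    {f : ℝ → ℝ} (hf : Measurable f) (h0 : ∀ x, 0 ≤ f x) (h1 : ∀ x, f x ≤ 1) :
    L1Le P (fun ω => z t ω * f (ξ t ω)) (q * ∫ x, f x ∂Pi) := by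
  have hfi : Integrable f Pi := Integrable.of_bound (C := 1) hf.aestronglyMeasurable
    (Eventually.of_forall fun x => by rw [Real.norm_eq_abs, abs_of_nonneg (h0 x)]; exact h1 x)
  refine (hM.l1Le_z t).mul_of_indepFun ⟨?_, le_of_eq ?_⟩ (hM.indepFun_z_ξ.comp
    (measurable_pi_apply t) (hf.comp (measurable_pi_apply t)))
  · rw [← hM.law_outlier t] at hfi
    exact hfi.comp_measurable (hM.measurable_outlier t)
  · simp only [abs_of_nonneg (h0 _)]
    rw [← hM.law_outlier t, integral_map (hM.measurable_outlier t).aemeasurable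
      hf.aestronglyMeasurable]

/-- Law of large numbers for functionals of the outliers. -/
theorem l1Le_sum_outlier (hM : IsModel P β ν A q Pi ε v z ξ) [IsProbabilityMeasure Pi]
    {k : ℝ → ℝ} (hk : Measurable k) (hk1 : ∀ x, |k x| ≤ 1) (s : Finset ℤ) (i : ℤ) :
    L1Le P (fun ω => ∑ t ∈ s, (z (t - i) ω * k (ξ (t - i) ω) - q * ∫ x, k x ∂Pi))
      (√(s.card * q)) := by
  set m := ∫ x, k x ∂Pi with hm
  have hmz := hM.measurable_z
  have hmξ := hM.measurable_outlier
  have hmeas : ∀ r, Measurable fun ω => z r ω * k (ξ r ω) := fun r => (hmz r).mul (hk.comp (hmξ r))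
  have hzb : ∀ r, ∀ᵐ ω ∂P, |z r ω| ≤ 1 := fun r => by
    filter_upwards [hM.z_values r] with ω hω
    rcases hω with h | h <;> simp [h]
  have hL : ∀ r, MemLp (fun ω => z r ω * k (ξ r ω)) 2 P := fun r => by
    refine MemLp.of_bound (hmeas r).aestronglyMeasurable 1 ?_
    filter_upwards [hzb r] with ω hω
    rw [norm_mul]
    exact mul_le_one₀ hω (norm_nonneg _) (hk1 _)
  have hkm : ∀ r, ∫ ω, k (ξ r ω) ∂P = m := fun r => by
    rw [hm, ← hM.law_outlier r, integral_map (hmξ r).aemeasurable hk.aestronglyMeasurable]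
  have hmean : ∀ r, ∫ ω, z r ω * k (ξ r ω) ∂P = q * m := fun r => by
    have h := hM.indepFun_z_ξ.comp (measurable_pi_apply r) (hk.comp (measurable_pi_apply r))
    have h2 := h.integral_fun_mul_eq_mul_integral (hmz r).aestronglyMeasurable
      (hk.comp (hmξ r)).aestronglyMeasurable
    simp only [Function.comp] at h2
    rw [h2, hM.integral_z, hkm]
  -- The z and ξ factors separate first, then the two times within each sequence; the covariances
  -- therefore vanish.
  have hprod : ∀ r r', r ≠ r' →
      ∫ ω, (z r ω * k (ξ r ω)) * (z r' ω * k (ξ r' ω)) ∂P = (q * m) * (q * m) := fun r r' hr => by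
    have h := hM.indepFun_z_ξ.comp (φ := fun w : ℤ → ℝ => w r * w r')
      (ψ := fun w : ℤ → ℝ => k (w r) * k (w r')) (by fun_prop) (by fun_prop)
    have h2 := h.integral_fun_mul_eq_mul_integral
      ((hmz r).mul (hmz r')).aestronglyMeasurable
      ((hk.comp (hmξ r)).mul (hk.comp (hmξ r'))).aestronglyMeasurable
    simp only [Function.comp] at h2
    have h3 := (hM.indep_z.indepFun hr).integral_fun_mul_eq_mul_integral
      (hmz r).aestronglyMeasurable (hmz r').aestronglyMeasurable
    have h4 := ((hM.indep_outlier.indepFun hr).comp hk hk).integral_fun_mul_eq_mul_integral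
      (hk.comp (hmξ r)).aestronglyMeasurable (hk.comp (hmξ r')).aestronglyMeasurable
    simp only [Function.comp] at h4
    rw [h3, h4, hM.integral_z, hM.integral_z, hkm, hkm] at h2
    rw [mul_mul_mul_comm q m q m, ← h2]
    exact integral_congr_ae (Eventually.of_forall fun ω => by ring)
  have hi : ∀ r, Integrable (fun ω => z r ω * k (ξ r ω)) P := fun r => (hL r).integrable (by norm_num)
  have hii : ∀ r r', Integrable (fun ω => (z r ω * k (ξ r ω)) * (z r' ω * k (ξ r' ω))) P :=
    fun r r' => (hL r).integrable_mul (hL r')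
  have hcov : ∀ r r', ∫ ω, (z r ω * k (ξ r ω) - q * m) * (z r' ω * k (ξ r' ω) - q * m) ∂P
      = ∫ ω, (z r ω * k (ξ r ω)) * (z r' ω * k (ξ r' ω)) ∂P - (q * m) * (q * m) := fun r r' => by
    have e : ∀ ω, (z r ω * k (ξ r ω) - q * m) * (z r' ω * k (ξ r' ω) - q * m)
        = ((z r ω * k (ξ r ω)) * (z r' ω * k (ξ r' ω)) + (q * m) * (q * m))
          - (q * m) * (z r ω * k (ξ r ω) + z r' ω * k (ξ r' ω)) := fun ω => by ring
    simp only [e]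
    rw [integral_sub
      (f := fun ω => (z r ω * k (ξ r ω)) * (z r' ω * k (ξ r' ω)) + (q * m) * (q * m))
      (g := fun ω => (q * m) * (z r ω * k (ξ r ω) + z r' ω * k (ξ r' ω)))
      ((hii r r').add (integrable_const _)) (((hi r).add (hi r')).const_mul _),
      integral_add (hii r r') (integrable_const _), integral_const, integral_const_mul,
      integral_add (hi r) (hi r'), hmean, hmean]
    simp
    ring
  have hLc : ∀ r, MemLp (fun ω => z r ω * k (ξ r ω) - q * m) 2 P := fun r =>
    (hL r).sub (memLp_const _)
  refine L1Le.of_sq (memLp_finsetSum s fun t _ => hLc (t - i)) ?_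
  rw [integral_sq_sum_of_orthogonal s _ fun t _ => hLc (t - i)]
  · calc _ ≤ ∑ _t ∈ s, q := Finset.sum_le_sum fun t _ => ?_
      _ = _ := by simp
    -- Since z² = z and |k| ≤ 1, the second moment is at most q rather than 1; this small variance
    -- makes the scaled sum vanish.
    have h1 : ∫ ω, (z (t - i) ω * k (ξ (t - i) ω)) * (z (t - i) ω * k (ξ (t - i) ω)) ∂P ≤ q := by
      rw [← hM.integral_z (t - i)]
      refine integral_mono_ae (hii _ _) (hM.l1Le_z _).1 ?_
      filter_upwards [hM.z_values (t - i)] with ω hω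
      have := hk1 (ξ (t - i) ω)
      rw [abs_le] at this
      rcases hω with h | h <;> simp only [h]
      · simp
      · nlinarith
    have h2 := hcov (t - i) (t - i)
    simp only [← sq] at h2 h1 ⊢
    rw [h2]
    linarith [sq_nonneg (q * m)]
  · intro t _ r _ htr
    rw [hcov, hprod _ _ (by omega), sub_self]

end Contamination

variable {n : ℕ} {Q₀ Q₁ : Measure ℝ} [IsProbabilityMeasure Q₀] [IsProbabilityMeasure Q₁]

/-! ### Mean bounds for the increments of the compensator -/

section Increments

theorem l1Le_sq_u (hM : IsModel P β ν (mixtureCdf Q₀ Q₁ n) q Pi ε v z ξ) (hn : 1 ≤ n)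
    (hQ₀ : SmoothCentered Q₀) (hQ₁ : SmoothCentered Q₁) (hβ : StableRoots β)
    (hμ : ν = deltaCoeff β * μ) (t : ℤ) :
    L1Le P (fun ω => (v t ω - μ) ^ 2) (stationaryVar β Q₀ Q₁) := by
  have h1 := hM.memLp_sum hn hQ₀ hQ₁ hβ hμ {t}
  have h2 := hM.integral_sum_sq_le hn hQ₀ hQ₁ hβ hμ {t}
  simp only [Finset.sum_singleton, Finset.card_singleton, Nat.cast_one, one_mul] at h1 h2
  refine ⟨h1.integrable_sq, ?_⟩
  simpa only [abs_sq] using h2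

theorem l1Le_abs_u (hM : IsModel P β ν (mixtureCdf Q₀ Q₁ n) q Pi ε v z ξ) (hn : 1 ≤ n)
    (hQ₀ : SmoothCentered Q₀) (hQ₁ : SmoothCentered Q₁) (hβ : StableRoots β)
    (hμ : ν = deltaCoeff β * μ) (t : ℤ) :
    L1Le P (fun ω => |v t ω - μ|) (√(stationaryVar β Q₀ Q₁)) := by
  have h1 := hM.memLp_sum hn hQ₀ hQ₁ hβ hμ {t}
  have h2 := hM.integral_sum_sq_le hn hQ₀ hQ₁ hβ hμ {t}
  simp only [Finset.sum_singleton, Finset.card_singleton, Nat.cast_one, one_mul] at h1 h2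
  exact (L1Le.of_sq h1 h2).abs

theorem measurable_pert_u (hM : IsModel P β ν A q Pi ε v z ξ) (μ τ : ℝ) (s : Fin p → ℝ) (κ : ℝ)
    (t : ℤ) : Measurable fun ω => pert τ s κ (fun r => v r ω - μ) t := by
  have := hM.measurable_v
  unfold pert
  fun_prop

theorem l1Le_sq_pert (hM : IsModel P β ν (mixtureCdf Q₀ Q₁ n) q Pi ε v z ξ) (hn : 1 ≤ n)
    (hQ₀ : SmoothCentered Q₀) (hQ₁ : SmoothCentered Q₁) (hβ : StableRoots β)
    (hμ : ν = deltaCoeff β * μ) (τ : ℝ) (s : Fin p → ℝ) (κ : ℝ) (t : ℤ) :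
    L1Le P (fun ω => pert τ s κ (fun r => v r ω - μ) t ^ 2)
      (pertVar τ s κ (stationaryVar β Q₀ Q₁)) := by
  have h1 := L1Le.sum_const (s := (Finset.univ : Finset (Fin p))) fun j _ =>
    hM.l1Le_sq_u hn hQ₀ hQ₁ hβ hμ (t - 1 - (j : ℤ))
  have h2 := (L1Le.const (P := P) (2 * (|τ| + |κ|) ^ 2)).add
    ((h1.const_mul p).const_mul (2 * (‖s‖ + |κ|) ^ 2))
  refine (h2.of_ae_le ((hM.measurable_pert_u μ τ s κ t).pow_const 2).aestronglyMeasurable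
    (Eventually.of_forall fun ω => ?_)).mono (le_of_eq ?_)
  · rw [abs_sq]
    exact pert_sq_le τ s κ _ t
  · rw [pertVar, abs_of_nonneg (by positivity : 0 ≤ 2 * (|τ| + |κ|) ^ 2),
      abs_of_nonneg (by positivity : 0 ≤ 2 * (‖s‖ + |κ|) ^ 2),
      abs_of_nonneg (by positivity : (0 : ℝ) ≤ p)]
    simp

theorem l1Le_pert (hM : IsModel P β ν (mixtureCdf Q₀ Q₁ n) q Pi ε v z ξ) (hn : 1 ≤ n)
    (hQ₀ : SmoothCentered Q₀) (hQ₁ : SmoothCentered Q₁) (hβ : StableRoots β)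
    (hμ : ν = deltaCoeff β * μ) (τ : ℝ) (s : Fin p → ℝ) (κ : ℝ) (t : ℤ) :
    L1Le P (fun ω => pert τ s κ (fun r => v r ω - μ) t)
      (√(pertVar τ s κ (stationaryVar β Q₀ Q₁))) := by
  have h := hM.l1Le_sq_pert hn hQ₀ hQ₁ hβ hμ τ s κ t
  refine L1Le.of_sq ((memLp_two_iff_integrable_sq
    (hM.measurable_pert_u μ τ s κ t).aestronglyMeasurable).2 h.1) ?_
  simpa only [abs_sq] using h.2

/-- The contamination is independent of v, so the mean factorises and gains both q and h. -/
theorem l1Le_z_mul_pert (hM : IsModel P β ν (mixtureCdf Q₀ Q₁ n) q Pi ε v z ξ) (hn : 1 ≤ n)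
    (hQ₀ : SmoothCentered Q₀) (hQ₁ : SmoothCentered Q₁) (hβ : StableRoots β)
    (hμ : ν = deltaCoeff β * μ) (τ : ℝ) (s : Fin p → ℝ) (κ : ℝ) {h : ℝ} (h0 : 0 ≤ h) (t : ℤ) :
    L1Le P (fun ω => outlierCount p (fun r => z r ω) t
        * |h * pert τ s κ (fun r => v r ω - μ) t|)
      ((p + 1) * q * (h * √(pertVar τ s κ (stationaryVar β Q₀ Q₁)))) := by
  have h1 := ((hM.l1Le_pert hn hQ₀ hQ₁ hβ hμ τ s κ t).const_mul h).abs
  rw [abs_of_nonneg h0] at h1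
  refine (hM.l1Le_outlierCount t).mul_of_indepFun h1 ?_
  refine (hM.indepFun_v_zξ.symm).comp
    (φ := fun y : (ℤ → ℝ) × (ℤ → ℝ) => outlierCount p y.1 t)
    (ψ := fun w : ℤ → ℝ => |h * pert τ s κ (fun r => w r - μ) t|) ?_ ?_
  · unfold outlierCount; fun_prop
  · unfold pert; fun_prop

/-- The argument of the indicator at time `t`, as a function of the sample paths. -/
noncomputable def threshold (β : Fin p → ℝ) (μ τ : ℝ) (s : Fin p → ℝ) (κ h : ℝ) (t : ℤ)
    (y : (ℤ → ℝ) × ((ℤ → ℝ) × (ℤ → ℝ))) : ℝ :=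
  shift β (fun r => y.2.1 r * y.2.2 r) t
    + h * pert τ s κ (fun r => y.1 r - μ + y.2.1 r * y.2.2 r) t

theorem measurable_threshold (β : Fin p → ℝ) (μ τ : ℝ) (s : Fin p → ℝ) (κ h : ℝ) (t : ℤ) :
    Measurable (threshold β μ τ s κ h t) := by
  unfold threshold shift pert
  fun_prop

/-- Predictability in v: the regressors are strictly lagged and the shift does not involve v. This
is the hypothesis `hDp` of the orthogonality lemmas. -/
theorem threshold_congr (β : Fin p → ℝ) (μ τ : ℝ) (s : Fin p → ℝ) (κ h : ℝ) (t : ℤ)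
    (w w' : ℤ → ℝ) (y : (ℤ → ℝ) × (ℤ → ℝ)) (hw : ∀ r < t, w r = w' r) :
    threshold β μ τ s κ h t (w, y) = threshold β μ τ s κ h t (w', y) := by
  have : ∀ j : Fin p, w (t - 1 - (j : ℤ)) = w' (t - 1 - (j : ℤ)) := fun j => hw _ (by omega)
  simp [threshold, pert, this]

theorem l1Le_increment (hM : IsModel P β ν (mixtureCdf Q₀ Q₁ n) q Pi ε v z ξ) (hn : 1 ≤ n)
    (hQ₀ : SmoothCentered Q₀) (hQ₁ : SmoothCentered Q₁) (hβ : StableRoots β)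
    (hμ : ν = deltaCoeff β * μ) {L C : ℝ} (hL : 0 ≤ L)
    (hA : SmoothBound (mixtureCdf Q₀ Q₁ n) L C)
    (τ : ℝ) (s : Fin p → ℝ) (κ : ℝ) {h : ℝ} (h0 : 0 ≤ h) (x : ℝ) (t : ℤ) :
    L1Le P (fun ω => mixtureCdf Q₀ Q₁ n (x + threshold β μ τ s κ h t (path v z ξ ω))
        - mixtureCdf Q₀ Q₁ n x)
      ((p + 1) * q + L * (h * √(pertVar τ s κ (stationaryVar β Q₀ Q₁)))) := by
  have h1 := (hM.l1Le_outlierCount t).add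
    (((hM.l1Le_pert hn hQ₀ hQ₁ hβ hμ τ s κ t).const_mul h).abs.const_mul L)
  rw [abs_of_nonneg h0, abs_of_nonneg hL] at h1
  have hm : Measurable (mixtureCdf Q₀ Q₁ n) := hA.differentiable.continuous.measurable
  refine h1.of_ae_le (Measurable.aestronglyMeasurable ?_) ?_
  · exact (hm.comp (((measurable_threshold β μ τ s κ h t).comp
      hM.measurable_path_prod).const_add x)).sub measurable_const
  · filter_upwards [hM.ae_z_values] with ω hω
    rw [threshold, ← add_assoc]
    exact abs_increment_le hA hL hω β τ s κ x h t

/-- When q is of order h each term of the bound is o(h), so n of them scaled by h sum to o(1); in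
the last term the small factor is the truncated integral. -/
theorem l1Le_taylor (hM : IsModel P β ν (mixtureCdf Q₀ Q₁ n) q Pi ε v z ξ)
    [IsProbabilityMeasure Pi] (hn : 1 ≤ n)
    (hQ₀ : SmoothCentered Q₀) (hQ₁ : SmoothCentered Q₁) (hβ : StableRoots β)
    (hμ : ν = deltaCoeff β * μ) {L C : ℝ} (hL : 0 ≤ L) (hC : 0 ≤ C)
    (hA : SmoothBound (mixtureCdf Q₀ Q₁ n) L C)
    (τ : ℝ) (s : Fin p → ℝ) (κ : ℝ) {h : ℝ} (h0 : 0 ≤ h) (x : ℝ) (t : ℤ) :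
    L1Le P (fun ω => mixtureCdf Q₀ Q₁ n (x + threshold β μ τ s κ h t (path v z ξ ω))
        - mixtureCdf Q₀ Q₁ n (x + shift β (fun r => z r ω * ξ r ω) t)
        - deriv (mixtureCdf Q₀ Q₁ n) x * (h * pert τ s κ (fun r => v r ω - μ) t))
      (C * (h ^ 2 * pertVar τ s κ (stationaryVar β Q₀ Q₁))
        + 2 * L * ((p + 1) * q * (h * √(pertVar τ s κ (stationaryVar β Q₀ Q₁))))
        + p * (q * ∫ y, min 1 (L * h * (‖s‖ + |κ|) * |y|) ∂Pi)) := by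
  have hmz := hM.measurable_z
  have hmξ := hM.measurable_outlier
  have h1 := ((hM.l1Le_sq_pert hn hQ₀ hQ₁ hβ hμ τ s κ t).const_mul (h ^ 2)).const_mul C
  have h2 := (hM.l1Le_z_mul_pert hn hQ₀ hQ₁ hβ hμ τ s κ h0 t).const_mul (2 * L)
  have h3 := L1Le.sum_const (s := (Finset.univ : Finset (Fin p))) fun j _ =>
    hM.l1Le_z_mul_outlier (t - 1 - (j : ℤ)) (f := fun y => min 1 (L * h * (‖s‖ + |κ|) * |y|))
      (by fun_prop) (fun y => le_min zero_le_one (by positivity)) (fun y => min_le_left _ _)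
  have h4 := (h1.add h2).add h3
  rw [abs_of_nonneg hC, abs_of_nonneg (by positivity : 0 ≤ h ^ 2),
    abs_of_nonneg (by positivity : 0 ≤ 2 * L), Finset.card_univ, Fintype.card_fin] at h4
  have hm : Measurable (mixtureCdf Q₀ Q₁ n) := hA.differentiable.continuous.measurable
  refine h4.of_ae_le (Measurable.aestronglyMeasurable ?_) ?_
  · refine Measurable.sub (Measurable.sub ?_ ?_) ?_
    · exact hm.comp (((measurable_threshold β μ τ s κ h t).comp
        hM.measurable_path_prod).const_add x)
    · refine hm.comp (Measurable.const_add ?_ x)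
      unfold shift; fun_prop
    · exact ((hM.measurable_pert_u μ τ s κ t).const_mul h).const_mul _
  · filter_upwards [hM.ae_z_values] with ω hω
    rw [threshold, ← add_assoc, ← mul_pow]
    exact abs_taylor_le hA hL hC hω β τ s κ x h0 t

theorem l1Le_shift_decomposition (hM : IsModel P β ν (mixtureCdf Q₀ Q₁ n) q Pi ε v z ξ)
    {L C L' C' : ℝ}
    (hA : SmoothBound (mixtureCdf Q₀ Q₁ n) L C) (hG : SmoothBound (fun x => cdf Q₀ x) L' C')
    (x : ℝ) (t : ℤ) :
    L1Le P (fun ω => mixtureCdf Q₀ Q₁ n (x + shift β (fun r => z r ω * ξ r ω) t)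
        - mixtureCdf Q₀ Q₁ n x - ∑ j : Fin (p + 1), z (t - (j : ℤ)) ω
        * (cdf Q₀ (x + Matrix.vecCons (-1) β j * ξ (t - (j : ℤ)) ω) - cdf Q₀ x))
      (2 * (√(n : ℝ))⁻¹ * ((p + 1) * q) + (p + 2) * ((p + 1) * ((p + 1) * q ^ 2))) := by
  have hmz := hM.measurable_z
  have hmξ := hM.measurable_outlier
  have hh : 0 ≤ (√(n : ℝ))⁻¹ := by positivity
  have h1 := ((hM.l1Le_outlierCount t).const_mul (2 * (√(n : ℝ))⁻¹)).add
    ((hM.l1Le_pairs t).const_mul ((p : ℝ) + 2))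
  rw [abs_of_nonneg (by positivity : 0 ≤ 2 * (√(n : ℝ))⁻¹),
    abs_of_nonneg (by positivity : (0 : ℝ) ≤ p + 2)] at h1
  have hm : Measurable (mixtureCdf Q₀ Q₁ n) := hA.differentiable.continuous.measurable
  have hmG : Measurable (fun x => cdf Q₀ x) := hG.differentiable.continuous.measurable
  refine h1.of_ae_le (Measurable.aestronglyMeasurable ?_) ?_
  · refine Measurable.sub (Measurable.sub ?_ measurable_const) ?_
    · refine hm.comp (Measurable.const_add ?_ x)
      unfold shift; fun_prop
    · refine Finset.measurable_sum _ fun j _ => (hmz _).mul (Measurable.sub ?_ measurable_const)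
      exact hmG.comp (((hmξ _).const_mul _).const_add x)
  · filter_upwards [hM.ae_z_values] with ω hω
    refine abs_shift_decomposition_le (G := fun x => cdf Q₀ x) hA.nonneg hA.le_one hG.nonneg
      hG.le_one (fun y => ?_) hω β x t
    rw [mixtureCdf, show (1 - (√(n : ℝ))⁻¹) * cdf Q₀ y + (√(n : ℝ))⁻¹ * cdf Q₁ y - cdf Q₀ y
      = (√(n : ℝ))⁻¹ * (cdf Q₁ y - cdf Q₀ y) by ring, abs_mul, abs_of_nonneg hh]
    refine mul_le_of_le_one_right hh ?_
    have := cdf_nonneg Q₀ y; have := cdf_le_one Q₀ y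
    have := cdf_nonneg Q₁ y; have := cdf_le_one Q₁ y
    rw [abs_le]; constructor <;> linarith

end Increments

end IsModel

/-! ### The asymptotic expansion for fixed parameters -/

theorem card_Icc_one (n : ℕ) : (Finset.Icc (1 : ℤ) n).card = n := by simp

/-- The scaled increment of the residual empirical distribution function for fixed parameters. -/
noncomputable def increment {Ω : Type*} {p : ℕ} (n : ℕ) (β : Fin p → ℝ) (μ τ : ℝ) (s : Fin p → ℝ)
    (κ x : ℝ) (ε v z ξ : ℤ → Ω → ℝ) (ω : Ω) : ℝ :=
  (√(n : ℝ))⁻¹ * ∑ t ∈ Finset.Icc (1 : ℤ) n,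
    (step (x + IsModel.threshold β μ τ s κ (√(n : ℝ))⁻¹ t (IsModel.path v z ξ ω)) (ε t ω)
      - step x (ε t ω))

/-- The average amount by which the perturbations are widened. -/
noncomputable def widening {Ω : Type*} (p n : ℕ) (μ : ℝ) (v : ℤ → Ω → ℝ) (ω : Ω) : ℝ :=
  (n : ℝ)⁻¹ * ∑ t ∈ Finset.Icc (1 : ℤ) n, (1 + ∑ j : Fin p, |v (t - 1 - (j : ℤ)) ω - μ|)

/-- A bound in mean for the remainder of the expansion, in terms of `h = n^{-1/2}`. -/
noncomputable def remainderRate {p : ℕ} (L C K Γ τ : ℝ) (s : Fin p → ℝ) (κ : ℝ) (Pi : Measure ℝ)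
    (h : ℝ) : ℝ :=
  √(4 * ((p + 1) * Γ + L * √(pertVar τ s κ K)) * h)
    + (C * pertVar τ s κ K * h + 2 * L * ((p + 1) * Γ * √(pertVar τ s κ K)) * h
      + p * Γ * ∫ y, min 1 (L * h * (‖s‖ + |κ|) * |y|) ∂Pi)
    + (2 * (p + 1) * Γ * h + (p + 2) * (p + 1) ^ 2 * Γ ^ 2 * h)
    + (p + 1) * √(Γ * h) + p * (L * ‖s‖ * √K) * h

/-- All terms are O(√h) except the truncated integral, which tends to 0 by dominated convergence
with majorant 1, whatever the tails of Π. -/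
theorem tendsto_remainderRate {p : ℕ} (L C K Γ τ : ℝ) (hL : 0 ≤ L) (s : Fin p → ℝ) (κ : ℝ)
    (Pi : Measure ℝ) [IsProbabilityMeasure Pi] :
    Tendsto (fun n : ℕ => remainderRate L C K Γ τ s κ Pi (√(n : ℝ))⁻¹) atTop (𝓝 0) := by
  have hh : Tendsto (fun n : ℕ => (√(n : ℝ))⁻¹) atTop (𝓝 0) :=
    tendsto_inv_atTop_zero.comp (Real.tendsto_sqrt_atTop.comp tendsto_natCast_atTop_atTop)
  have hint : Tendsto (fun n : ℕ => ∫ y, min 1 (L * (√(n : ℝ))⁻¹ * (‖s‖ + |κ|) * |y|) ∂Pi) atTop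
      (𝓝 (∫ _y, (0 : ℝ) ∂Pi)) := by
    refine tendsto_integral_of_dominated_convergence (fun _ => 1)
      (fun n => Measurable.aestronglyMeasurable (by fun_prop)) (integrable_const _)
      (fun n => Eventually.of_forall fun y => ?_) (Eventually.of_forall fun y => ?_)
    · rw [Real.norm_eq_abs, abs_of_nonneg (le_min zero_le_one (by positivity))]
      exact min_le_left _ _
    · have h1 : Tendsto (fun n : ℕ => L * (√(n : ℝ))⁻¹ * (‖s‖ + |κ|) * |y|) atTop (𝓝 0) := by
        simpa using ((hh.const_mul L).mul_const (‖s‖ + |κ|)).mul_const |y|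
      simpa using (tendsto_const_nhds (x := (1 : ℝ))).min h1
  rw [integral_zero] at hint
  have hc : ∀ c : ℝ, Tendsto (fun n : ℕ => c * (√(n : ℝ))⁻¹) atTop (𝓝 0) := fun c => by
    simpa using hh.const_mul c
  have hs : ∀ c : ℝ, Tendsto (fun n : ℕ => √(c * (√(n : ℝ))⁻¹)) atTop (𝓝 0) := fun c => by
    simpa using (hc c).sqrt
  unfold remainderRate
  have e : (0 : ℝ) + (0 + 0 + p * Γ * 0) + (0 + 0) + (p + 1) * 0 + 0 = 0 := by ring
  rw [← e]
  exact ((((hs _).add (((hc _).add (hc _)).add (hint.const_mul (p * Γ)))).add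
    ((hc _).add (hc _))).add ((hs _).const_mul ((p : ℝ) + 1))).add (hc _)

theorem outlierShift_eq {p : ℕ} (β : Fin p → ℝ) (Q₀ Pi : Measure ℝ) [IsProbabilityMeasure Pi]
    [IsProbabilityMeasure Q₀] (hm : Measurable (fun x => cdf Q₀ x)) (x : ℝ) :
    outlierShift β Q₀ Pi x = ∑ j : Fin (p + 1),
      ∫ y, (cdf Q₀ (x + Matrix.vecCons (-1) β j * y) - cdf Q₀ x) ∂Pi := by
  refine Finset.sum_congr rfl fun j _ => ?_
  rw [integral_sub _ (integrable_const _)]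
  · simp
  · refine Integrable.of_bound (C := 1) (hm.comp (by fun_prop)).aestronglyMeasurable
      (Eventually.of_forall fun y => ?_)
    rw [Real.norm_eq_abs, abs_of_nonneg (cdf_nonneg _ _)]
    exact cdf_le_one _ _

namespace IsModel

variable {Ω : Type*} [MeasurableSpace Ω] {P : Measure Ω} [IsProbabilityMeasure P]
  {p : ℕ} {β : Fin p → ℝ} {ν μ : ℝ} {Pi : Measure ℝ} {ε v z ξ : ℤ → Ω → ℝ}
  {n : ℕ} {q : ℝ} {Q₀ Q₁ : Measure ℝ} [IsProbabilityMeasure Q₀] [IsProbabilityMeasure Q₁]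

theorem l1Le_widening (hM : IsModel P β ν (mixtureCdf Q₀ Q₁ n) q Pi ε v z ξ) (hn : 1 ≤ n)
    (hQ₀ : SmoothCentered Q₀) (hQ₁ : SmoothCentered Q₁) (hβ : StableRoots β)
    (hμ : ν = deltaCoeff β * μ) :
    L1Le P (widening p n μ v) (1 + p * √(stationaryVar β Q₀ Q₁)) := by
  have h1 := (L1Le.sum_const (s := Finset.Icc (1 : ℤ) n) fun t _ =>
    (L1Le.const (P := P) 1).add (L1Le.sum_const (s := (Finset.univ : Finset (Fin p))) fun j _ =>
      hM.l1Le_abs_u hn hQ₀ hQ₁ hβ hμ (t - 1 - (j : ℤ)))).const_mul (n : ℝ)⁻¹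
  refine h1.mono (le_of_eq ?_)
  have : (n : ℝ) ≠ 0 := by positivity
  rw [card_Icc_one, abs_of_nonneg (by positivity)]
  simp
  field_simp

/-- Pure algebra from h² n = 1 and q = γh, valid for arbitrary A, G, a and m. The five sums are the
orthogonal part, the Taylor error, the error in splitting the shift, the fluctuation of the outlier
terms and the fluctuation of v. -/
theorem remainder_eq (hn : 1 ≤ n) (γ a : ℝ) (hq : q = γ * (√(n : ℝ))⁻¹)
    (A G : ℝ → ℝ) (m : Fin (p + 1) → ℝ) (τ : ℝ) (s : Fin p → ℝ) (κ x : ℝ) (ω : Ω) :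
    increment n β μ τ s κ x ε v z ξ ω - a * (τ + κ * widening p n μ v ω) - γ * ∑ j, m j
      = (√(n : ℝ))⁻¹ * ∑ t ∈ Finset.Icc (1 : ℤ) n,
          centredStep A x (ε t ω) (threshold β μ τ s κ (√(n : ℝ))⁻¹ t (path v z ξ ω))
        + (√(n : ℝ))⁻¹ * ∑ t ∈ Finset.Icc (1 : ℤ) n,
          (A (x + threshold β μ τ s κ (√(n : ℝ))⁻¹ t (path v z ξ ω))
            - A (x + shift β (fun r => z r ω * ξ r ω) t)
            - a * ((√(n : ℝ))⁻¹ * pert τ s κ (fun r => v r ω - μ) t))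
        + (√(n : ℝ))⁻¹ * ∑ t ∈ Finset.Icc (1 : ℤ) n,
          (A (x + shift β (fun r => z r ω * ξ r ω) t) - A x
            - ∑ j : Fin (p + 1), z (t - (j : ℤ)) ω
              * (G (x + Matrix.vecCons (-1) β j * ξ (t - (j : ℤ)) ω) - G x))
        + ∑ j : Fin (p + 1), (√(n : ℝ))⁻¹ * ∑ t ∈ Finset.Icc (1 : ℤ) n,
          (z (t - (j : ℤ)) ω
            * (G (x + Matrix.vecCons (-1) β j * ξ (t - (j : ℤ)) ω) - G x) - q * m j)
        + ∑ j : Fin p, (a * s j * (n : ℝ)⁻¹) * ∑ t ∈ Finset.Icc (1 : ℤ) n,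
          (v (t - 1 - (j : ℤ)) ω - μ) := by
  have hn0 : (n : ℝ) ≠ 0 := by positivity
  set h := (√(n : ℝ))⁻¹ with hh
  have hh2 : h * h = (n : ℝ)⁻¹ := by
    rw [hh, ← mul_inv, Real.mul_self_sqrt (by positivity)]
  have hpert : ∑ t ∈ Finset.Icc (1 : ℤ) n, pert τ s κ (fun r => v r ω - μ) t
      = n * τ + ∑ j : Fin p, s j * ∑ t ∈ Finset.Icc (1 : ℤ) n, (v (t - 1 - (j : ℤ)) ω - μ)
        + κ * (n * widening p n μ v ω) := by
    simp only [pert, widening, Finset.sum_add_distrib, Finset.sum_const, card_Icc_one]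
    rw [← Finset.mul_sum, Finset.sum_comm]
    simp only [Finset.mul_sum, Finset.sum_add_distrib, Finset.sum_const, card_Icc_one,
      nsmul_eq_mul, mul_add]
    field_simp
  have hlast : ∑ j : Fin p, (a * s j * (n : ℝ)⁻¹) * ∑ t ∈ Finset.Icc (1 : ℤ) n,
      (v (t - 1 - (j : ℤ)) ω - μ)
      = a * (n : ℝ)⁻¹ * ∑ j : Fin p, s j * ∑ t ∈ Finset.Icc (1 : ℤ) n,
        (v (t - 1 - (j : ℤ)) ω - μ) := by
    rw [Finset.mul_sum]; exact Finset.sum_congr rfl fun j _ => by ring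
  have hout : ∑ j : Fin (p + 1), h * ∑ t ∈ Finset.Icc (1 : ℤ) n,
          (z (t - (j : ℤ)) ω
            * (G (x + Matrix.vecCons (-1) β j * ξ (t - (j : ℤ)) ω) - G x) - q * m j)
      = h * ∑ t ∈ Finset.Icc (1 : ℤ) n, ∑ j : Fin (p + 1), z (t - (j : ℤ)) ω
            * (G (x + Matrix.vecCons (-1) β j * ξ (t - (j : ℤ)) ω) - G x)
        - γ * ∑ j, m j := by
    rw [← Finset.mul_sum, Finset.sum_comm]
    simp only [Finset.sum_sub_distrib, ← Finset.mul_sum, Finset.sum_const, card_Icc_one,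
      nsmul_eq_mul]
    rw [mul_sub, hq]
    congr 1
    calc h * (γ * h * (n * ∑ j, m j)) = (h * h * n) * (γ * ∑ j, m j) := by ring
      _ = _ := by rw [hh2, inv_mul_cancel₀ hn0, one_mul]
  rw [hlast, hout, increment]
  set S := ∑ j : Fin p, s j * ∑ t ∈ Finset.Icc (1 : ℤ) n, (v (t - 1 - (j : ℤ)) ω - μ)
  simp only [centredStep, Finset.sum_sub_distrib, ← Finset.mul_sum]
  rw [hpert, ← hh, ← hh2]
  have h1 : h * h * n = 1 := by rw [hh2, inv_mul_cancel₀ hn0]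
  linear_combination (a * τ + a * κ * widening p n μ v ω) * h1

/-- The expansion of the increment for fixed parameters. -/
theorem l1Le_remainder {γ Γ : ℝ} (hγ : γ ∈ Set.Icc 0 Γ)
    (hM : IsModel P β ν (mixtureCdf Q₀ Q₁ n) (γ * (√(n : ℝ))⁻¹) Pi ε v z ξ)
    [IsProbabilityMeasure Pi] (hn : 1 ≤ n)
    (hQ₀ : SmoothCentered Q₀) (hQ₁ : SmoothCentered Q₁) (hβ : StableRoots β)
    (hμ : ν = deltaCoeff β * μ) {L C L' C' : ℝ} (hL : 0 ≤ L) (hC : 0 ≤ C)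
    (hA : SmoothBound (mixtureCdf Q₀ Q₁ n) L C) (hG : SmoothBound (fun x => cdf Q₀ x) L' C')
    (τ : ℝ) (s : Fin p → ℝ) (κ x : ℝ) :
    L1Le P (fun ω => increment n β μ τ s κ x ε v z ξ ω
        - deriv (mixtureCdf Q₀ Q₁ n) x * (τ + κ * widening p n μ v ω)
        - γ * outlierShift β Q₀ Pi x)
      (remainderRate L C (stationaryVar β Q₀ Q₁) Γ τ s κ Pi (√(n : ℝ))⁻¹) := by
  have hmA : Measurable (mixtureCdf Q₀ Q₁ n) := hA.differentiable.continuous.measurable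
  have hmG : Measurable (fun x => cdf Q₀ x) := hG.differentiable.continuous.measurable
  have hn0 : (0 : ℝ) < n := by positivity
  obtain ⟨hγ0, hγΓ⟩ := hγ
  have hΓ0 := hγ0.trans hγΓ
  rw [outlierShift_eq β Q₀ Pi hmG x]
  simp only [remainder_eq (β := β) (μ := μ) (ε := ε) (v := v) (z := z) (ξ := ξ) hn γ
    (deriv (mixtureCdf Q₀ Q₁ n) x) rfl (mixtureCdf Q₀ Q₁ n) (fun x => cdf Q₀ x)]
  set h := (√(n : ℝ))⁻¹ with hh
  have h0 : 0 < h := by positivity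
  have hh2 : h * h * n = 1 := by
    rw [hh, ← mul_inv, Real.mul_self_sqrt hn0.le, inv_mul_cancel₀ hn0.ne']
  set K := stationaryVar β Q₀ Q₁ with hK
  have hK0 : 0 ≤ K := stationaryVar_nonneg _ _ _
  set B := pertVar τ s κ K with hB
  have hB0 : 0 ≤ B := by rw [hB, pertVar]; positivity
  have hsq : ∀ c : ℝ, h * √(n * c) = √c := fun c => by
    conv_lhs => rw [← Real.sqrt_mul_self h0.le]
    rw [← Real.sqrt_mul (by positivity), ← mul_assoc, hh2, one_mul]
  have hnh : ∀ c : ℝ, h * (n * (h * c)) = c := fun c => by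
    rw [show h * (n * (h * c)) = h * h * n * c by ring, hh2, one_mul]
  -- One goal for each sum of `remainder_eq`, matching the terms of `remainderRate` in order.
  refine (((L1Le.add ?_ ?_).add ?_).add ?_).add ?_
  · have h1 := (hM.l1Le_sum_centredStep hβ hμ hmA (measurable_threshold β μ τ s κ h)
      (threshold_congr β μ τ s κ h) x (Finset.Icc (1 : ℤ) n) fun t _ =>
        hM.l1Le_increment hn hQ₀ hQ₁ hβ hμ hL hA τ s κ h0.le x t).const_mul h
    refine h1.mono ?_
    rw [card_Icc_one, abs_of_pos h0, hsq]
    apply Real.sqrt_le_sqrt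
    have : (p + 1) * (γ * h) ≤ (p + 1) * (Γ * h) := by gcongr
    linarith
  · have h1 := (L1Le.sum_const (s := Finset.Icc (1 : ℤ) n) fun t _ =>
      hM.l1Le_taylor hn hQ₀ hQ₁ hβ hμ hL hC hA τ s κ h0.le x t).const_mul h
    refine h1.mono ?_
    rw [card_Icc_one, abs_of_pos h0, ← hK, ← hB]
    have hI : 0 ≤ ∫ y, min 1 (L * h * (‖s‖ + |κ|) * |y|) ∂Pi :=
      integral_nonneg fun y => le_min zero_le_one (by positivity)
    set I := ∫ y, min 1 (L * h * (‖s‖ + |κ|) * |y|) ∂Pi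
    rw [show C * (h ^ 2 * B) + 2 * L * ((p + 1) * (γ * h) * (h * √B)) + p * (γ * h * I)
      = h * (C * B * h + 2 * L * ((p + 1) * γ * √B) * h + p * γ * I) by ring, hnh]
    gcongr
  · have h1 := (L1Le.sum_const (s := Finset.Icc (1 : ℤ) n) fun t _ =>
      hM.l1Le_shift_decomposition hA hG x t).const_mul h
    refine h1.mono ?_
    rw [card_Icc_one, abs_of_pos h0, ← hh]
    rw [show 2 * h * ((p + 1) * (γ * h)) + ((p : ℝ) + 2) * ((p + 1) * ((p + 1) * (γ * h) ^ 2))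
      = h * (2 * (p + 1) * γ * h + (p + 2) * (p + 1) ^ 2 * γ ^ 2 * h) by ring, hnh]
    gcongr
  · have h1 := L1Le.sum_const (s := (Finset.univ : Finset (Fin (p + 1)))) fun j _ =>
      (hM.l1Le_sum_outlier (k := fun y => cdf Q₀ (x + Matrix.vecCons (-1) β j * y) - cdf Q₀ x)
        ((hmG.comp (by fun_prop)).sub measurable_const)
        (fun y => hG.abs_sub_le_one _ _) (Finset.Icc (1 : ℤ) n) (j : ℤ)).const_mul h
    refine h1.mono ?_
    rw [card_Icc_one, abs_of_pos h0, hsq]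
    simp only [Finset.card_univ, Fintype.card_fin, Nat.cast_add, Nat.cast_one]
    gcongr
  -- Lagged values over 1, …, n are values of v over a translated index set of the same cardinality.
  · have hshift : ∀ j : Fin p, L1Le P (fun ω => ∑ t ∈ Finset.Icc (1 : ℤ) n,
        (v (t - 1 - (j : ℤ)) ω - μ)) (√(n * K)) := fun j => by
      have h1 := L1Le.of_sq (hM.memLp_sum hn hQ₀ hQ₁ hβ hμ
        ((Finset.Icc (1 : ℤ) n).map (addRightEmbedding (-1 - (j : ℤ)))))
        (hM.integral_sum_sq_le hn hQ₀ hQ₁ hβ hμ _)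
      rw [Finset.card_map, card_Icc_one] at h1
      have e : ∀ t : ℤ, t + (-1 - (j : ℤ)) = t - 1 - (j : ℤ) := fun t => by ring
      simp only [Finset.sum_map, addRightEmbedding_apply, e] at h1
      exact h1
    have h1 := L1Le.sum_const (B := L * ‖s‖ * √K * h) (s := (Finset.univ : Finset (Fin p)))
      fun j _ => ((hshift j).const_mul
        (deriv (mixtureCdf Q₀ Q₁ n) x * s j * (n : ℝ)⁻¹)).mono ?_
    · refine h1.mono (le_of_eq ?_)
      simp only [Finset.card_univ, Fintype.card_fin]
      ring
    · have e : (n : ℝ)⁻¹ = h * h := by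
        rw [hh, ← mul_inv, Real.mul_self_sqrt hn0.le]
      rw [abs_mul, abs_mul, e, abs_of_nonneg (by positivity : 0 ≤ h * h),
        show |deriv (mixtureCdf Q₀ Q₁ n) x| * |s j| * (h * h) * √(n * K)
        = |deriv (mixtureCdf Q₀ Q₁ n) x| * |s j| * (h * √(n * K)) * h by ring, hsq]
      gcongr
      · exact hA.deriv_le x
      · exact norm_le_pi_norm s j

end IsModel

/-! ### Uniformity in the parameters -/

/-- The indicator is monotone in its threshold, and the widening by κ(1 + ∑|u|) dominates any
parameter change of size κ. This lets random parameters be replaced by a deterministic centre. -/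
theorem increment_bracket {Ω : Type*} {p : ℕ} (n : ℕ) (β : Fin p → ℝ) (μ : ℝ) {τ τ' : ℝ}
    {s s' : Fin p → ℝ} {κ : ℝ} (h1 : |τ - τ'| ≤ κ) (h2 : ‖s - s'‖ ≤ κ) (x : ℝ)
    (ε v z ξ : ℤ → Ω → ℝ) (ω : Ω) :
    increment n β μ τ' s' (-κ) x ε v z ξ ω ≤ increment n β μ τ s 0 x ε v z ξ ω ∧
      increment n β μ τ s 0 x ε v z ξ ω ≤ increment n β μ τ' s' κ x ε v z ξ ω := by
  have h0 : 0 ≤ (√(n : ℝ))⁻¹ := by positivity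
  constructor <;>
  · refine mul_le_mul_of_nonneg_left (Finset.sum_le_sum fun t _ =>
      sub_le_sub_right (step_mono ?_ _) _) h0
    have h3 := abs_pert_sub_le h1 h2
      (fun r => (IsModel.path v z ξ ω).1 r - μ
        + (IsModel.path v z ξ ω).2.1 r * (IsModel.path v z ξ ω).2.2 r) t
    have h4 := mul_le_mul_of_nonneg_left h3.1 h0
    have h5 := mul_le_mul_of_nonneg_left h3.2 h0
    simp only [IsModel.threshold]
    linarith

/-- The estimated process is the increment evaluated at the scaled estimation errors without
widening. -/
theorem sqrt_mul_empiricalCdf_sub {Ω : Type*} {p n : ℕ} (hn : 1 ≤ n) (β b : Fin p → ℝ) (μ m : ℝ)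
    (x : ℝ) (ε v z ξ : ℤ → Ω → ℝ) (ω : Ω)
    (hrec : ∀ t, v t ω - μ = ∑ j : Fin p, β j * (v (t - 1 - (j : ℤ)) ω - μ) + ε t ω) :
    √(n : ℝ) * (empiricalCdf n (residual m b (obsProcess v z ξ ω)) x
        - empiricalCdf n (fun t => ε t ω) x)
      = increment n β μ (√(n : ℝ) * (m - μ) * (1 - ∑ j, b j)) (√(n : ℝ) • (b - β)) 0 x ε v z ξ ω := by
  have hn0 : (0 : ℝ) < n := by positivity
  have hs : 0 < √(n : ℝ) := Real.sqrt_pos.2 hn0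
  have e : √(n : ℝ) * (n : ℝ)⁻¹ = (√(n : ℝ))⁻¹ := by
    rw [← Real.mul_self_sqrt hn0.le, mul_inv, Real.sqrt_mul_self hs.le,
      mul_inv_cancel_left₀ hs.ne']
  rw [empiricalCdf, empiricalCdf, ← mul_sub, ← mul_assoc, e, increment, ← Finset.sum_sub_distrib]
  congr 1
  refine Finset.sum_congr rfl fun t _ => ?_
  have h1 := residual_le_iff (b := b) (m := m) (inv_pos.2 hs) (v := fun r => v r ω)
    (z := fun r => z r ω) (w := fun r => ξ r ω) (e := fun r => ε r ω) (hrec t) x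
  rw [inv_inv, add_assoc] at h1
  change step x _ - step x _ = _
  congr 1
  rw [step_eq, step_eq]
  exact if_congr h1 rfl rfl

theorem deriv_mixtureCdf {Q₀ Q₁ : Measure ℝ} (h₀ : Differentiable ℝ fun x => cdf Q₀ x)
    (h₁ : Differentiable ℝ fun x => cdf Q₁ x) (n : ℕ) (x : ℝ) :
    deriv (mixtureCdf Q₀ Q₁ n) x = (1 - (√(n : ℝ))⁻¹) * deriv (fun s => cdf Q₀ s) x
      + (√(n : ℝ))⁻¹ * deriv (fun s => cdf Q₁ s) x :=
  (((h₀ x).hasDerivAt.const_mul (1 - (√(n : ℝ))⁻¹)).add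
    ((h₁ x).hasDerivAt.const_mul (√(n : ℝ))⁻¹)).deriv

theorem contaminationLevel_eq {γ Γ : ℝ} (hγ : γ ∈ Set.Icc 0 Γ) {n : ℕ}
    (hn : Γ * (√(n : ℝ))⁻¹ ≤ 1) : contaminationLevel γ n = γ * (√(n : ℝ))⁻¹ := by
  rw [contaminationLevel, div_eq_mul_inv]
  exact min_eq_right ((mul_le_mul_of_nonneg_right hγ.2 (by positivity)).trans hn)

/-- Deterministic estimate behind the expansion: a value between two brackets inherits their
expansion. -/
theorem abs_expansion_le {N Np Nm a τ κ W D δ c : ℝ} (hlo : Nm ≤ N) (hhi : N ≤ Np)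
    (hp : |Np - a * (τ + κ * W) - D| < δ / 4) (hm : |Nm - a * (τ + -κ * W) - D| < δ / 4)
    (hW : |a * (κ * W)| ≤ δ / 8) (hc : |a * τ - c| ≤ 3 * δ / 8) : |N - c - D| ≤ δ := by
  rw [abs_lt] at hp hm
  rw [abs_le] at hW hc ⊢
  constructor <;> nlinarith [hp.1, hp.2, hm.1, hm.2, hW.1, hW.2, hc.1, hc.2]

/-- Error in replacing the centre of a bracket by the parameter of interest. -/
theorem abs_centre_sub_le {a g L τ t₁ d S κ h R Θ : ℝ} {p : ℕ} (hL : 0 ≤ L) (hh : 0 ≤ h)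
    (ha : |a| ≤ L) (hg : |g| ≤ L) (hag : |a - g| ≤ h * L) (hτ : |t₁ * (d - h * S) - τ| ≤ κ)
    (hR : |t₁ * (d - h * S)| ≤ R) (ht : |t₁| ≤ Θ) (hS : |S| ≤ p * Θ) :
    |a * τ - g * d * t₁| ≤ L * κ + h * (L * (R + p * Θ ^ 2)) := by
  set T := t₁ * (d - h * S) with hT
  have e : a * τ - g * d * t₁ = -(a * (T - τ)) + (a - g) * T + -(g * (h * (t₁ * S))) := by
    rw [hT]; ring
  have hΘ : 0 ≤ Θ := (abs_nonneg _).trans ht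
  have h1 : |a * (T - τ)| ≤ L * κ := by
    rw [abs_mul]; exact mul_le_mul ha hτ (abs_nonneg _) hL
  have h2 : |(a - g) * T| ≤ h * L * R := by
    rw [abs_mul]; exact mul_le_mul hag hR (abs_nonneg _) (mul_nonneg hh hL)
  have h3 : |g * (h * (t₁ * S))| ≤ L * (h * (Θ * (p * Θ))) := by
    rw [abs_mul, abs_mul h, abs_mul t₁, abs_of_nonneg hh]
    gcongr
  rw [e]
  refine (abs_add_three _ _ _).trans ?_
  rw [abs_neg, abs_neg]
  refine (add_le_add_three h1 h2 h3).trans (le_of_eq ?_)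
  ring

end ContaminatedAR

/-! ### Proof of the theorem -/

open ContaminatedAR in
theorem mainTheorem2
    {p : ℕ} (β : Fin p → ℝ) (hβ : ContaminatedAR.StableRoots β)
    (ν μ : ℝ) (hμ : ν = ContaminatedAR.deltaCoeff β * μ)
    (Q₀ Q₁ : Measure ℝ) [IsProbabilityMeasure Q₀] [IsProbabilityMeasure Q₁]
    (hQ₀ : ContaminatedAR.SmoothCentered Q₀) (hQ₁ : ContaminatedAR.SmoothCentered Q₁)
    (Pi : Measure ℝ) [IsProbabilityMeasure Pi]
    (Γ : ℝ) (hΓ : 0 ≤ Γ)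
    {Ω : ℕ → ℝ → Type*} [∀ n γ, MeasurableSpace (Ω n γ)]
    (P : ∀ n γ, Measure (Ω n γ)) [∀ n γ, IsProbabilityMeasure (P n γ)]
    (ε v z ξ : ∀ n γ, ℤ → Ω n γ → ℝ)
    (hmodel : ∀ n : ℕ, 1 ≤ n → ∀ γ ∈ Set.Icc 0 Γ,
      ContaminatedAR.IsModel (P n γ) β ν (ContaminatedAR.mixtureCdf Q₀ Q₁ n)
        (ContaminatedAR.contaminationLevel γ n) Pi (ε n γ) (v n γ) (z n γ) (ξ n γ))
    (muHat : ∀ n : ℕ, ContaminatedAR.Sample p n → ℝ) (hmuHat : ∀ n, Measurable (muHat n))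
    (betaHat : ∀ n : ℕ, ContaminatedAR.Sample p n → Fin p → ℝ)
    (hbetaHat : ∀ n, Measurable (betaHat n))
    (hmu : ContaminatedAR.UniformlyBigOP P Γ (fun n γ ω =>
      √(n : ℝ) * (muHat n (ContaminatedAR.sample p n
        (ContaminatedAR.obsProcess (v n γ) (z n γ) (ξ n γ) ω)) - μ)))
    (hbeta : ContaminatedAR.UniformlyBigOP P Γ (fun n γ ω =>
      √(n : ℝ) • (betaHat n (ContaminatedAR.sample p n
        (ContaminatedAR.obsProcess (v n γ) (z n γ) (ξ n γ) ω)) - β)))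
    (x : ℝ) (δ : ℝ) (hδ : 0 < δ) :
    Tendsto
      (fun n : ℕ => ⨆ γ ∈ Set.Icc 0 Γ, P n γ {ω |
        let y := ContaminatedAR.obsProcess (v n γ) (z n γ) (ξ n γ) ω
        let m := muHat n (ContaminatedAR.sample p n y)
        let b := betaHat n (ContaminatedAR.sample p n y)
        δ < |√(n : ℝ) * (ContaminatedAR.empiricalCdf n (ContaminatedAR.residual m b y) x
                - ContaminatedAR.empiricalCdf n (fun t => ε n γ t ω) x)
              - deriv (fun s => cdf Q₀ s) x * ContaminatedAR.deltaCoeff β * (√(n : ℝ) * (m - μ))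
              - γ * ContaminatedAR.outlierShift β Q₀ Pi x|})
      atTop (𝓝 0) := by
  obtain ⟨L₀, C₀, hL₀, hC₀, hS₀⟩ := hQ₀.exists_smoothBound
  obtain ⟨L₁, C₁, hL₁, hC₁, hS₁⟩ := hQ₁.exists_smoothBound
  set L := L₀ + L₁ with hLdef
  have hL : 0 ≤ L := add_nonneg hL₀ hL₁
  set K := stationaryVar β Q₀ Q₁
  set W := 1 + p * √K with hW
  have hh : Tendsto (fun n : ℕ => (√(n : ℝ))⁻¹) atTop (𝓝 0) :=
    tendsto_inv_atTop_zero.comp (Real.tendsto_sqrt_atTop.comp tendsto_natCast_atTop_atTop)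
  suffices H : ∀ η : ℝ, 0 < η → ∀ᶠ n : ℕ in atTop, ∀ γ ∈ Set.Icc 0 Γ, P n γ {ω |
        let y := obsProcess (v n γ) (z n γ) (ξ n γ) ω
        let m := muHat n (sample p n y)
        let b := betaHat n (sample p n y)
        δ < |√(n : ℝ) * (empiricalCdf n (residual m b y) x - empiricalCdf n (fun t => ε n γ t ω) x)
              - deriv (fun s => cdf Q₀ s) x * deltaCoeff β * (√(n : ℝ) * (m - μ))
              - γ * outlierShift β Q₀ Pi x|} ≤ ENNReal.ofReal η by
    rw [ENNReal.tendsto_nhds_zero]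
    intro e he
    obtain ⟨η, hη0, hηe⟩ := ENNReal.lt_iff_exists_real_btwn.1 he
    filter_upwards [H η (ENNReal.ofReal_pos.1 hηe.1)] with n hn
    exact iSup₂_le fun γ hγ => (hn γ hγ).trans hηe.2.le
  intro η hη
  obtain ⟨Θ₁, hΘ₁⟩ := hmu (η / 4) (by positivity)
  obtain ⟨Θ₂, hΘ₂⟩ := hbeta (η / 4) (by positivity)
  set Θ := max (max Θ₁ Θ₂) 0
  have hΘ0 : 0 ≤ Θ := le_max_right _ _
  -- The ball must contain both s, of norm at most Θ, and τ, bounded by Θ(|δ(β)| + pΘ) because h ≤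
  -- 1.
  set R := max Θ (Θ * (|deltaCoeff β| + p * Θ))
  -- The first bound controls the replacement of τ by the centre of its ball; the second is Markov's
  -- inequality for the cost of widening.
  obtain ⟨κ, hκ0, hκ1, hκ2⟩ : ∃ κ : ℝ, 0 < κ ∧ L * κ ≤ δ / 8 ∧ L * κ * W / (δ / 8) ≤ η / 4 := by
    have h1 : Tendsto (fun κ : ℝ => L * κ) (𝓝[>] 0) (𝓝 0) := by
      have : Tendsto (fun κ : ℝ => L * κ) (𝓝 0) (𝓝 (L * 0)) := tendsto_id.const_mul L
      rw [mul_zero] at this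
      exact this.mono_left nhdsWithin_le_nhds
    have h2 : Tendsto (fun κ : ℝ => L * κ * W / (δ / 8)) (𝓝[>] 0) (𝓝 0) := by
      simpa using (h1.mul_const W).div_const (δ / 8)
    obtain ⟨κ, h3, h4, h5⟩ := ((h1.eventually_le_const (show 0 < δ / 8 by positivity)).and
      ((h2.eventually_le_const (show 0 < η / 4 by positivity)).and self_mem_nhdsWithin)).exists
    exact ⟨κ, h5, h3, h4⟩
  -- The net depends neither on n nor on γ, so a union bound over it keeps the estimate uniform.
  obtain ⟨F₀, -, hF₀, hcover⟩ := (isCompact_closedBall (0 : ℝ × (Fin p → ℝ)) R).finite_cover_balls hκ0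
  classical
  set F := hF₀.toFinset ×ˢ ({κ, -κ} : Finset ℝ) with hF
  have hrate : Tendsto (fun n : ℕ => ∑ c ∈ F, ENNReal.ofReal
      (remainderRate L (C₀ + C₁) K Γ c.1.1 c.1.2 c.2 Pi (√(n : ℝ))⁻¹ / (δ / 4))) atTop (𝓝 0) := by
    rw [← Finset.sum_const_zero (s := F)]
    refine tendsto_finsetSum F fun c _ => ?_
    have := (tendsto_remainderRate L (C₀ + C₁) K Γ c.1.1 hL c.1.2 c.2 Pi).div_const (δ / 4)
    rw [zero_div] at this
    simpa using ENNReal.tendsto_ofReal this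
  have hhΓ : Tendsto (fun n : ℕ => Γ * (√(n : ℝ))⁻¹) atTop (𝓝 0) := by simpa using hh.const_mul Γ
  have hhR : Tendsto (fun n : ℕ => (√(n : ℝ))⁻¹ * (L * (R + p * Θ ^ 2))) atTop (𝓝 0) := by
    simpa using hh.mul_const (L * (R + p * Θ ^ 2))
  -- The condition Γh ≤ 1 makes the minimum in the contamination level inactive for all γ ≤ Γ at
  -- once.
  filter_upwards [hΘ₁, hΘ₂, eventually_ge_atTop 1, hhΓ.eventually_le_const one_pos,
    hhR.eventually_le_const (show 0 < δ / 4 by positivity),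
    hrate.eventually_le_const (ENNReal.ofReal_pos.2 (show 0 < η / 4 by positivity))]
    with n h1 h2 hn hnΓ hnR hnrate γ hγ
  have hM := hmodel n hn γ hγ
  rw [contaminationLevel_eq hγ hnΓ] at hM
  have h0 : 0 ≤ (√(n : ℝ))⁻¹ := by positivity
  have hle1 := invSqrt_le_one hn
  have hA : SmoothBound (mixtureCdf Q₀ Q₁ n) L (C₀ + C₁) := hS₀.convexComb hS₁ h0 hle1
  have hrem := fun c : (ℝ × (Fin p → ℝ)) × ℝ => hM.l1Le_remainder hγ hn hQ₀ hQ₁ hβ hμ hL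
    (add_nonneg hC₀ hC₁) hA hS₀ c.1.1 c.1.2 c.2 x
  have hwid := ((hM.l1Le_widening hn hQ₀ hQ₁ hβ hμ).const_mul (L * κ)).measure_le
    (show 0 < δ / 8 by positivity)
  rw [abs_of_nonneg (by positivity : 0 ≤ L * κ)] at hwid
  have hunion : P n γ (⋃ c ∈ F, {ω | δ / 4 ≤ |increment n β μ c.1.1 c.1.2 c.2 x (ε n γ) (v n γ)
      (z n γ) (ξ n γ) ω - deriv (mixtureCdf Q₀ Q₁ n) x * (c.1.1 + c.2 * widening p n μ (v n γ) ω)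
        - γ * outlierShift β Q₀ Pi x|}) ≤ ENNReal.ofReal (η / 4) :=
    (measure_biUnion_finset_le F _).trans ((Finset.sum_le_sum fun c _ =>
      (hrem c).measure_le (by positivity)).trans hnrate)
  -- Four exceptional events of probability at most η / 4 each: a large centre error, a large
  -- coefficient error, a large widening, a failed expansion at some point of the net.
  have htotal := (measure_union_le _ _).trans (add_le_add ((measure_union_le _ _).trans
    (add_le_add ((measure_union_le _ _).trans (add_le_add (h1 γ hγ) (h2 γ hγ)))
      (hwid.trans (ENNReal.ofReal_le_ofReal hκ2)))) hunion)
  rw [← ENNReal.ofReal_add (by positivity) (by positivity),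
    ← ENNReal.ofReal_add (by positivity) (by positivity),
    ← ENNReal.ofReal_add (by positivity) (by positivity),
    show η / 4 + η / 4 + η / 4 + η / 4 = η by ring] at htotal
  refine (measure_mono_ae ?_).trans htotal
  filter_upwards [hM.ae_recursion hμ] with ω hrec hω
  by_contra hcon
  change ω ∉ (_ ∪ _ ∪ _ ∪ _ : Set _) at hcon
  simp only [Set.mem_union, not_or, Set.mem_iUnion, not_exists] at hcon
  obtain ⟨⟨⟨hE1, hE2⟩, hE3⟩, hE4⟩ := hcon
  have hω' : δ < _ := hω
  set m := muHat n (sample p n (obsProcess (v n γ) (z n γ) (ξ n γ) ω))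
  set b := betaHat n (sample p n (obsProcess (v n γ) (z n γ) (ξ n γ) ω))
  have hs0 : 0 < √(n : ℝ) := Real.sqrt_pos.2 (by positivity)
  have ht1 : |√(n : ℝ) * (m - μ)| ≤ Θ :=
    (not_lt.1 hE1).trans ((le_max_left _ _).trans (le_max_left _ _))
  have ht2 : ‖√(n : ℝ) • (b - β)‖ ≤ Θ :=
    (not_lt.1 hE2).trans ((le_max_right _ _).trans (le_max_left _ _))
  set S := ∑ j, (√(n : ℝ) • (b - β)) j with hS
  have hSle : |S| ≤ p * Θ := by
    refine (Finset.abs_sum_le_sum_abs _ _).trans ?_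
    calc _ ≤ ∑ _j : Fin p, Θ := Finset.sum_le_sum fun j _ => (norm_le_pi_norm _ j).trans ht2
      _ = p * Θ := by simp
  have hτ : 1 - ∑ j, b j = deltaCoeff β - (√(n : ℝ))⁻¹ * S := by
    rw [hS, deltaCoeff]
    have e : ∀ j, (√(n : ℝ) • (b - β)) j = √(n : ℝ) * (b j - β j) := fun _ => rfl
    simp only [e]
    rw [← Finset.mul_sum, inv_mul_cancel_left₀ hs0.ne', Finset.sum_sub_distrib]
    ring
  have hTR : |√(n : ℝ) * (m - μ) * (1 - ∑ j, b j)| ≤ R := by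
    refine le_trans ?_ (le_max_right _ _)
    rw [hτ, abs_mul]
    refine mul_le_mul ht1 ((abs_sub _ _).trans (add_le_add le_rfl ?_)) (abs_nonneg _) hΘ0
    rw [abs_mul, abs_of_nonneg h0]
    exact (mul_le_of_le_one_left (abs_nonneg _) hle1).trans hSle
  have hmem : (√(n : ℝ) * (m - μ) * (1 - ∑ j, b j), √(n : ℝ) • (b - β))
      ∈ Metric.closedBall (0 : ℝ × (Fin p → ℝ)) R := by
    rw [mem_closedBall_zero_iff, Prod.norm_def]
    exact max_le hTR (ht2.trans (le_max_left _ _))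
  -- The random parameters lie within κ of a net point, whose two widened increments bracket the
  -- estimated process and satisfy the expansion off the exceptional events.
  obtain ⟨c, hc, hcball⟩ := Set.mem_iUnion₂.1 (hcover hmem)
  rw [Metric.mem_ball, dist_eq_norm, Prod.norm_def, max_lt_iff] at hcball
  obtain ⟨hc1, hc2⟩ := hcball
  have hbr := increment_bracket n β μ (κ := κ) hc1.le hc2.le x (ε n γ) (v n γ) (z n γ) (ξ n γ) ω
  rw [← sqrt_mul_empiricalCdf_sub hn β b μ m x (ε n γ) (v n γ) (z n γ) (ξ n γ) ω hrec] at hbr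
  have hcF : ∀ κ' ∈ ({κ, -κ} : Finset ℝ), (c, κ') ∈ F := fun κ' hκ' =>
    Finset.mem_product.2 ⟨hF₀.mem_toFinset.2 hc, hκ'⟩
  simp only [Set.mem_ofPred_eq, not_le] at hE3 hE4
  have hp := hE4 (c, κ) (hcF κ (by simp))
  have hm := hE4 (c, -κ) (hcF (-κ) (by simp))
  have ha := hA.deriv_le x
  have hg : |deriv (fun s => cdf Q₀ s) x| ≤ L := (hS₀.deriv_le x).trans (by linarith)
  have hag : |deriv (mixtureCdf Q₀ Q₁ n) x - deriv (fun s => cdf Q₀ s) x| ≤ (√(n : ℝ))⁻¹ * L := by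
    rw [deriv_mixtureCdf hQ₀.differentiable hQ₁.differentiable,
      show ∀ h a b : ℝ, (1 - h) * a + h * b - a = h * (b - a) from fun h a b => by ring,
      abs_mul, abs_of_nonneg h0]
    refine mul_le_mul_of_nonneg_left ((abs_sub _ _).trans ?_) h0
    linarith [hS₀.deriv_le x, hS₁.deriv_le x]
  have hWle : |deriv (mixtureCdf Q₀ Q₁ n) x * (κ * widening p n μ (v n γ) ω)| ≤ δ / 8 := by
    have h3 := hE3.le
    rw [abs_mul, abs_of_nonneg (by positivity : 0 ≤ L * κ)] at h3
    rw [abs_mul, abs_mul, abs_of_pos hκ0]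
    refine le_trans (mul_le_mul_of_nonneg_right ha (by positivity)) ?_
    rwa [← mul_assoc]
  -- The error is at most Lκ + h L (R + pΘ²) ≤ δ/8 + δ/4, the 3δ/8 allowed in `abs_expansion_le`.
  have hcen := abs_centre_sub_le (p := p) (τ := c.1) hL h0 ha hg hag (hτ ▸ hc1.le) (hτ ▸ hTR)
    ht1 hSle
  refine absurd (abs_expansion_le hbr.1 hbr.2 hp hm hWle (hcen.trans ?_)) (not_le.2 hω')
  linarith
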